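/- Let $\mathcal B=\mathbb C[[t_0,t_1,t_2,\dots]]$, $\mathbf t=(t_0,t_1,\dots)$, $x=t_0$, with $(-1)!!=1$, and for $\tau\in\mathcal B$ put $$\tau(\mathbf t\mp[z^{-1}])=\tau\Big(t_0\mp z^{-1},\dots,t_k\mp\frac{(2k-1)!!}{z^{2k+1}},\dots\Big),\qquad \vartheta(z;\mathbf t)=\sum_{j\ge 0}t_j\frac{z^{2j+1}}{(2j+1)!!}.$$ Let $\tau\in\mathcal B$, $\tau\neq 0$, be a tau-function of the KdV hierarchy, i.e. for all $p=0,1,2,\dots$ the Hirota bilinear identities $$\operatorname*{res}_{z=\infty}\ \tau(\mathbf t-[z^{-1}])\,\tau(\tilde{\mathbf t}+[z^{-1}])\,\exp\Big(\sum_{j\ge 0}\frac{t_j-\tilde t_j}{(2j+1)!!}z^{2j+1}\Big)z^{2p}\,dz=0$$ hold identically in $\mathbf t,\tilde{\mathbf t}$, where the residue is minus the coefficient of $z^{-1}$ in the formal expansion. Define $$\psi(z;\mathbf t)=\frac{\tau(\mathbf t-[z^{-1}])}{\tau(\mathbf t)}e^{\vartheta(z;\mathbf t)},\qquad \psi^*(z;\mathbf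 t)=\psi(-z;\mathbf t),$$ $$\mathcal R(z)=\psi(z;\mathbf t)\,\psi^*(z;\mathbf t),\qquad \chi(z)=\partial_x\log\psi(z;\mathbf t)=\psi_x/\psi,$$ and the generating function of the two-point correlation functions $$F_2(z,w;\mathbf t)=\sum_{k,l\ge 0}\frac{\partial^2\log\tau}{\partial t_k\,\partial t_l}(\mathbf t)\,\frac{(2k+1)!!}{z^{2k+2}}\,\frac{(2l+1)!!}{w^{2l+2}}.$$ Here $\partial^2\log\tau/\partial t_k\partial t_l=\partial_{t_k}\big(\tau_{t_l}/\tau\big)$, and quotients are taken in fields of fractions of the formal series rings. Then $$F_2(z,w;\mathbf t)=\frac{\tfrac12\mathcal R_x(w)\mathcal R_x(z)-\mathcal R(w)\mathcal R(z)\chi(z)\chi(-z)-\mathcal R(z)\mathcal R(w)\chi(w)\chi(-w)-(z^2+w^2)}{(z^2-w^2)^2}.$$ -/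

import Mathlib

noncomputable section

namespace KdV

open scoped Nat

/-! ## Derivations on a field of fractions -/

/-- The extension of a derivation `d` of a domain `A` to the field of fractions, by the quotient
rule applied to a chosen representation `x = a / b`; see `fracDeriv_div`. -/
def fracDeriv {R A : Type*} [CommRing R] [CommRing A] [IsDomain A] [Algebra R A]
    (d : Derivation R A A) (x : FractionRing A) : FractionRing A :=
  let a : A := (IsLocalization.sec (nonZeroDivisors A) x).1
  let b : A := ((IsLocalization.sec (nonZeroDivisors A) x).2 : A)
  algebraMap A (FractionRing A) (d a * b - a * d b) / algebraMap A (FractionRing A) b ^ 2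

/-- The quotient rule holds for every representation `a / b`, not only for the chosen one. -/
theorem fracDeriv_div {R A : Type*} [CommRing R] [CommRing A] [IsDomain A] [Algebra R A]
    (d : Derivation R A A) (a b : A) (hb : b ≠ 0) :
    fracDeriv d (algebraMap A (FractionRing A) a / algebraMap A (FractionRing A) b) =
      algebraMap A (FractionRing A) (d a * b - a * d b) /
        algebraMap A (FractionRing A) b ^ 2 := by
  have inj := IsFractionRing.injective A (FractionRing A)
  set x : FractionRing A := algebraMap A _ a / algebraMap A _ b with hx
  unfold fracDeriv
  set a' : A := (IsLocalization.sec (nonZeroDivisors A) x).1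
  set b' : A := ((IsLocalization.sec (nonZeroDivisors A) x).2 : A) with hb'
  have hb'0 : b' ≠ 0 := nonZeroDivisors.ne_zero (IsLocalization.sec (nonZeroDivisors A) x).2.2
  have hB : algebraMap A (FractionRing A) b ≠ 0 := fun h => hb (inj (by simpa using h))
  have hB' : algebraMap A (FractionRing A) b' ≠ 0 := fun h => hb'0 (inj (by simpa using h))
  have hs : x * algebraMap A _ b' = algebraMap A _ a' :=
    IsLocalization.sec_spec (nonZeroDivisors A) x
  have e : a * b' = a' * b := by
    apply inj
    rw [map_mul, map_mul, ← hs, hx]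
    field_simp
  have de := congrArg d e
  simp only [Derivation.leibniz, smul_eq_mul] at de
  rw [div_eq_div_iff (pow_ne_zero 2 hB') (pow_ne_zero 2 hB)]
  simp only [← map_pow, ← map_mul]
  congr 1
  linear_combination (-(b * b')) * de + (b' * d b + b * d b') * e

/-! ## Formal power series in the times -/

/-- The Bosonic Fock space `ℂ[[t₀, t₁, t₂, …]]`. -/
abbrev Fock : Type := MvPowerSeries ℕ ℂ

instance fock_isDomain : IsDomain Fock := NoZeroDivisors.to_isDomain _

/-- The series `t_k - (2k-1)!! ξ^(2k+1)` in `ℂ[[t₀, t₁, …, ξ]]`. The variable `ξ` has the index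
`none`; note that `(2 * 0 - 1)‼ = 0‼ = 1 = (-1)!!`. -/
def miwaArg (k : ℕ) : MvPowerSeries (Option ℕ) ℂ :=
  MvPowerSeries.X (some k) -
    MvPowerSeries.C (((2 * k - 1)‼ : ℕ) : ℂ) * MvPowerSeries.X none ^ (2 * k + 1)

/-- `τ(t - [ξ])` makes sense for every formal power series `τ`. -/
theorem hasSubst_miwaArg : MvPowerSeries.HasSubst miwaArg where
  const_coeff k := by simp [miwaArg]
  coeff_zero d := by
    classical
    refine (Set.finite_le_nat (d none)).union (d.support.finite_toSet.preimage
      (Option.some_injective ℕ).injOn) |>.subset ?_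
    intro k hk
    by_contra hcon
    simp only [Set.mem_union, not_or, Set.mem_ofPred_eq, not_le, Set.mem_preimage,
      Finset.mem_coe, Finsupp.mem_support_iff, not_not] at hcon
    apply hk
    have h1 : d ≠ Finsupp.single (some k) 1 := by
      rintro rfl
      simp at hcon
    have h2 : d ≠ Finsupp.single none (2 * k + 1) := by
      rintro rfl
      simp only [Finsupp.single_eq_same] at hcon
      omega
    rw [miwaArg, map_sub, MvPowerSeries.coeff_C_mul, MvPowerSeries.coeff_X,
      MvPowerSeries.coeff_X_pow, if_neg h1, if_neg h2, mul_zero, sub_zero]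

/-- `τ(t - [ξ]) = τ(t₀ - ξ, …, t_k - (2k-1)!! ξ^(2k+1), …)`, an element of `ℂ[[t, ξ]]` regarded as
a power series in `t` whose coefficients are power series in `ξ`. -/
def miwaShift (τ : Fock) : MvPowerSeries ℕ (PowerSeries ℂ) :=
  fun a => PowerSeries.mk fun n =>
    MvPowerSeries.coeff (Finsupp.optionElim n a) (MvPowerSeries.subst miwaArg τ)

theorem coeff_coeff_miwaShift (τ : Fock) (a : ℕ →₀ ℕ) (n : ℕ) :
    PowerSeries.coeff n (MvPowerSeries.coeff a (miwaShift τ)) =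
      MvPowerSeries.coeff (Finsupp.optionElim n a) (MvPowerSeries.subst miwaArg τ) := by
  have h : MvPowerSeries.coeff a (miwaShift τ) = PowerSeries.mk fun n =>
    MvPowerSeries.coeff (Finsupp.optionElim n a) (MvPowerSeries.subst miwaArg τ) := rfl
  rw [h, PowerSeries.coeff_mk]

/-! ## Spectral parameters

A spectral parameter `z` in a field `k` is given by a ring homomorphism `ι : ℂ[[ξ]] → k`, the
expansion at `z = ∞`, through which `ξ` stands for `z⁻¹`. -/

section Spectral

variable {k : Type*} [Field k] [Algebra ℂ k]

/-- The value of the spectral parameter. -/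
def param (ι : PowerSeries ℂ →+* k) : k := (ι PowerSeries.X)⁻¹

/-- The spectral parameter `-z`. -/
def neg (ι : PowerSeries ℂ →+* k) : PowerSeries ℂ →+* k := ι.comp PowerSeries.evalNegHom

/-- `τ(t - [z⁻¹])`. Replacing `z` by `-z` this is `τ(t + [z⁻¹])`. -/
def shifted (τ : Fock) (ι : PowerSeries ℂ →+* k) : MvPowerSeries ℕ k :=
  MvPowerSeries.map ι (miwaShift τ)

/-- The phase `ϑ(z; t) = ∑_j t_j z^(2j+1) / (2j+1)!!`, coefficient by coefficient. -/
def phase (z : k) : MvPowerSeries ℕ k := fun a =>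
  ∑ j ∈ a.support, if a = Finsupp.single j 1 then z ^ (2 * j + 1) / ((2 * j + 1)‼ : ℕ) else 0

/-- The exponential of a power series without constant term. -/
def expOf {σ : Type*} (f : MvPowerSeries σ k) : MvPowerSeries σ k :=
  PowerSeries.subst f (PowerSeries.exp ℂ)

end Spectral

theorem coeff_phase {k : Type*} [Field k] (z : k) (a : ℕ →₀ ℕ) :
    MvPowerSeries.coeff a (phase z) = ∑ j ∈ a.support,
      if a = Finsupp.single j 1 then z ^ (2 * j + 1) / ((2 * j + 1)‼ : ℕ) else 0 := rfl

theorem coeff_single_phase {k : Type*} [Field k] (z : k) (j : ℕ) :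
    MvPowerSeries.coeff (Finsupp.single j 1) (phase z) =
      z ^ (2 * j + 1) / ((2 * j + 1)‼ : ℕ) := by
  rw [coeff_phase, Finset.sum_eq_single j, if_pos rfl]
  · intro i hi hij
    simp only [Finsupp.mem_support_iff, Finsupp.single_apply_ne_zero] at hi
    exact absurd hi.1 hij
  · simp

theorem constantCoeff_phase {k : Type*} [Field k] (z : k) :
    MvPowerSeries.constantCoeff (phase z) = 0 := by
  rw [← MvPowerSeries.coeff_zero_eq_constantCoeff_apply, coeff_phase, Finsupp.support_zero,
    Finset.sum_empty]

/-! ## The Hirota bilinear identities -/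

/-- The expansion at `z = ∞` into `ℂ((z⁻¹))`; the variable of the Laurent series is `z⁻¹`. -/
def expand : PowerSeries ℂ →+* LaurentSeries ℂ := HahnSeries.ofPowerSeries ℤ ℂ

/-- The residue at `z = ∞` of `f(z) dz`: minus the coefficient of `z⁻¹`. -/
def resInfty (f : LaurentSeries ℂ) : ℂ := -HahnSeries.coeff f 1

/-- A function of `t`, as a function of the two families of times `t` and `t̃`. -/
def inT (f : MvPowerSeries ℕ (LaurentSeries ℂ)) : MvPowerSeries (ℕ ⊕ ℕ) (LaurentSeries ℂ) :=
  MvPowerSeries.rename Function.Embedding.inl f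

/-- A function of `t̃`, as a function of the two families of times `t` and `t̃`. -/
def inT' (f : MvPowerSeries ℕ (LaurentSeries ℂ)) : MvPowerSeries (ℕ ⊕ ℕ) (LaurentSeries ℂ) :=
  MvPowerSeries.rename Function.Embedding.inr f

/-- The integrand of the bilinear identity of index `p`,
`τ(t - [z⁻¹]) τ(t̃ + [z⁻¹]) exp(∑_{j ≥ 0} (t_j - t̃_j) z^(2j+1) / (2j+1)!!) z^(2p)`,
a power series in `t`, `t̃` whose coefficients are Laurent series in `z⁻¹`. -/
def bilinearIntegrand (τ : Fock) (p : ℕ) : MvPowerSeries (ℕ ⊕ ℕ) (LaurentSeries ℂ) :=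
  inT (shifted τ expand) * inT' (shifted τ (neg expand)) *
    expOf (inT (phase (param expand)) - inT' (phase (param expand))) *
    MvPowerSeries.C (param expand ^ (2 * p))

/-- The Hirota bilinear identities of the KdV hierarchy. -/
def IsTauFunction (τ : Fock) : Prop :=
  ∀ (p : ℕ) (d : ℕ ⊕ ℕ →₀ ℕ), resInfty (MvPowerSeries.coeff d (bilinearIntegrand τ p)) = 0

/-! ## Correlation functions -/

/-- The two-point correlation function `∂² log τ / ∂t_k ∂t_l`, in the field of fractions of
`ℂ[[t]]` (it lies in `ℂ[[t]]` if `τ(0) ≠ 0`). -/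
def corr (τ : Fock) (k l : ℕ) : FractionRing Fock :=
  fracDeriv (MvPowerSeries.pderiv ℂ k)
    (fracDeriv (MvPowerSeries.pderiv ℂ l) (algebraMap Fock (FractionRing Fock) τ) /
      algebraMap Fock (FractionRing Fock) τ)

/-- The numerator of the two-point correlation function over the common denominator `τ²`. -/
def corrNum (τ : Fock) (k l : ℕ) : Fock :=
  MvPowerSeries.pderiv ℂ k (MvPowerSeries.pderiv ℂ l τ) * τ -
    MvPowerSeries.pderiv ℂ l τ * MvPowerSeries.pderiv ℂ k τ

theorem corr_eq (τ : Fock) (hτ : τ ≠ 0) (k l : ℕ) :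
    corr τ k l = algebraMap Fock (FractionRing Fock) (corrNum τ k l) /
      algebraMap Fock (FractionRing Fock) τ ^ 2 := by
  have h : fracDeriv (MvPowerSeries.pderiv ℂ l) (algebraMap Fock (FractionRing Fock) τ) =
      algebraMap Fock (FractionRing Fock) (MvPowerSeries.pderiv ℂ l τ) := by
    have := fracDeriv_div (MvPowerSeries.pderiv ℂ l) τ 1 one_ne_zero
    simpa using this
  rw [corr, h, fracDeriv_div _ _ _ hτ, corrNum]

/-! ## Functions of two spectral parameters -/

/-- The field of fractions of `ℂ[[z⁻¹, w⁻¹]]`, which contains `z` and `w`. -/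
abbrev Coef : Type := FractionRing (MvPowerSeries (Fin 2) ℂ)

instance twoVar_isDomain : IsDomain (MvPowerSeries (Fin 2) ℂ) := NoZeroDivisors.to_isDomain _

/-- Power series in the times `t` whose coefficients are functions of `z` and `w`. -/
abbrev Funs : Type := MvPowerSeries ℕ Coef

instance funs_isDomain : IsDomain Funs := NoZeroDivisors.to_isDomain _

/-- The field in which the two-point formula is stated: the field of fractions of `Funs`. -/
abbrev Big : Type := FractionRing Funs

/-- The spectral parameter `z`: `ξ` is the first variable of `ℂ[[z⁻¹, w⁻¹]]`. -/
def zPar : PowerSeries ℂ →+* Coef :=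
  (algebraMap (MvPowerSeries (Fin 2) ℂ) Coef).comp
    (PowerSeries.toMvPowerSeries (R := ℂ) (0 : Fin 2)).toRingHom

/-- The spectral parameter `w`: `ξ` is the second variable of `ℂ[[z⁻¹, w⁻¹]]`. -/
def wPar : PowerSeries ℂ →+* Coef :=
  (algebraMap (MvPowerSeries (Fin 2) ℂ) Coef).comp
    (PowerSeries.toMvPowerSeries (R := ℂ) (1 : Fin 2)).toRingHom

/-- `τ(t)` in the large field. -/
def tauBig (τ : Fock) : Big :=
  algebraMap Funs Big (MvPowerSeries.map (algebraMap ℂ Coef) τ)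

/-- The value of a spectral parameter in the large field. -/
def paramBig (ι : PowerSeries ℂ →+* Coef) : Big :=
  algebraMap Funs Big (MvPowerSeries.C (param ι))

/-- The derivative `∂_x = ∂/∂t₀`. -/
def dx (f : Big) : Big := fracDeriv (MvPowerSeries.pderiv Coef 0) f

/-- The wave function `ψ(z; t) = τ(t - [z⁻¹]) / τ(t) * exp(ϑ(z; t))`. -/
def wave (τ : Fock) (ι : PowerSeries ℂ →+* Coef) : Big :=
  algebraMap Funs Big (shifted τ ι) / tauBig τ * algebraMap Funs Big (expOf (phase (param ι)))

/-- The dual wave function `ψ*(z; t) = ψ(-z; t)`. -/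
def waveDual (τ : Fock) (ι : PowerSeries ℂ →+* Coef) : Big := wave τ (neg ι)

/-- `R(z; t) = ψ(z; t) ψ*(z; t)`. -/
def resolvent (τ : Fock) (ι : PowerSeries ℂ →+* Coef) : Big := wave τ ι * waveDual τ ι

/-- `χ(z; t) = ∂_x log ψ(z; t)`. -/
def chi (τ : Fock) (ι : PowerSeries ℂ →+* Coef) : Big := dx (wave τ ι) / wave τ ι

/-- For a family `c_{kl}` in `ℂ[[t]]`, the series
`∑_{k,l ≥ 0} c_{kl}(t) (2k+1)!! (2l+1)!! z^(-2k-2) w^(-2l-2)`: for each monomial in `t`, the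
coefficient is the element of `ℂ[[z⁻¹, w⁻¹]]` given by its coefficients. -/
def genSeries (c : ℕ → ℕ → Fock) : Funs := fun a =>
  algebraMap (MvPowerSeries (Fin 2) ℂ) Coef fun e =>
    ∑ k ∈ Finset.range (e 0), ∑ l ∈ Finset.range (e 1),
      if e 0 = 2 * k + 2 ∧ e 1 = 2 * l + 2 then
        MvPowerSeries.coeff a (c k l) * ((2 * k + 1)‼ : ℕ) * ((2 * l + 1)‼ : ℕ) else 0

/-- The generating function `F₂(z, w; t)` of the two-point correlation functions. The sum is taken
over the common denominator `τ²` of all of them, see `corr_eq`. -/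
def F₂ (τ : Fock) : Big := algebraMap Funs Big (genSeries (corrNum τ)) / tauBig τ ^ 2

end KdV

end

/-!
Let `∇(z) = ∑_k (2k+1)!! z^(-2k-2) ∂/∂t_k`, so that `F₂ = ∇(z) ∇(w) log τ`. Four bilinear identities
with shifted arguments carry the proof:

* `shift_unshift_wronskian`: the Wronskian of `ψ(z)` and `ψ(-z)` is `-2 z`;
* `shift_wronskian`, `unshift_wronskian`: the Wronskians of `ψ(z)`, `ψ(w)` and of `ψ(-z)`, `ψ(-w)`
  are, up to exponential factors, `(w - z) τ(t - [z⁻¹] - [w⁻¹]) / τ` and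
  `(z - w) τ(t + [z⁻¹] + [w⁻¹]) / τ`;
* `insert_insert`: `(z + w)² F₂ = τ(t - [z⁻¹] - [w⁻¹]) τ(t + [z⁻¹] + [w⁻¹]) / τ² - 1`.

The last three give
`(z² - w²)² F₂ = -R(z) R(w) (χ(z) - χ(w)) (χ(-z) - χ(-w)) - (z - w)²` (`F₂_mul_sq`), and since
`R_x = R(z) (χ(z) + χ(-z))`, the identity `R(z) (χ(z) - χ(-z)) = 2 z` turns this into the two-point
formula.

The bilinear identities come from a purely algebraic form of the Hirota identities. Differentiating
the integrand in `t` and `t̃` and restricting to `t̃ = t` shows that, for every bilinear operator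
`C` in `BiOp = ℂ[∂_t] ⊗ ℂ[∂_t̃]`, the residue of `z^(2p) C^conj V(z)`, evaluated at `τ ⊗ τ`,
vanishes (`hirota_residue_conj`). Here `C^conj` is the conjugate of `C` by the exponential factor, a
polynomial in `z`, and `V(z)` (`pairVertex`) is the vertex operator of
`τ(t - [z⁻¹]) τ(t̃ + [z⁻¹])`. For this one needs that the substitution `t ↦ t - [ξ]` is the vertex
operator `exp (-∑ (2k-1)!! ξ^(2k+1) ∂/∂t_k)` (`miwaCoeff_eq_act`).

Taking for `C` a product of vertex operators makes `C^conj` contain factors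
`((1 + z ξ) / (1 - z ξ))^(1/2)`. Because all even powers `z^(2p)` are allowed, they may be
multiplied by `(1 - z² ξ²)^(-1/2)`, which leaves the rational kernels `1 / (1 - z ξ)`
(`hirotaSeries_kernel`).
Their residues are values of `V` and of its derivative at `z = ξ⁻¹`, where the vertex operators
cancel in pairs.
-/

noncomputable section

namespace KdV

open scoped Nat TensorProduct

/-! ### Coefficientwise maps and iterated power series -/

section Coeffwise

variable {σ τ R S T : Type*}

/-- An additive map applied to all coefficients of a power series. -/
def coeffwise [Semiring R] [Semiring S] (L : R →+ S) :
    MvPowerSeries σ R →+ MvPowerSeries σ S where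
  toFun F := fun e => L (MvPowerSeries.coeff e F)
  map_zero' := by
    ext e
    exact L.map_zero
  map_add' F G := by
    ext e
    exact (congrArg L (map_add _ F G)).trans (L.map_add _ _)

theorem coeff_coeffwise [Semiring R] [Semiring S] (L : R →+ S) (F : MvPowerSeries σ R)
    (e : σ →₀ ℕ) : MvPowerSeries.coeff e (coeffwise L F) = L (MvPowerSeries.coeff e F) := rfl

/-- A coefficientwise semilinear map is semilinear over power series. -/
theorem coeffwise_map_mul [Semiring R] [Semiring S] [Semiring T] (L : R →+ S) (f : T →+* R)
    (g : T →+* S) (h : ∀ c x, L (f c * x) = g c * L x) (F : MvPowerSeries σ T)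
    (G : MvPowerSeries σ R) :
    coeffwise L (MvPowerSeries.map f F * G) = MvPowerSeries.map g F * coeffwise L G := by
  classical
  ext e
  rw [coeff_coeffwise, MvPowerSeries.coeff_mul, MvPowerSeries.coeff_mul, map_sum]
  simp only [MvPowerSeries.coeff_map, h, coeff_coeffwise]

/-- The exchange of two groups of variables as a map, see `swap`. -/
def swapFun [CommSemiring R] (F : MvPowerSeries τ (MvPowerSeries σ R)) :
    MvPowerSeries σ (MvPowerSeries τ R) :=
  fun a e => MvPowerSeries.coeff a (MvPowerSeries.coeff e F)

theorem coeff_coeff_swapFun [CommSemiring R] (F : MvPowerSeries τ (MvPowerSeries σ R))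
    (a : σ →₀ ℕ) (e : τ →₀ ℕ) : MvPowerSeries.coeff e (MvPowerSeries.coeff a (swapFun F)) =
      MvPowerSeries.coeff a (MvPowerSeries.coeff e F) := rfl

/-- The exchange of two groups of variables, `R[[σ]][[τ]] → R[[τ]][[σ]]`. -/
def swap (σ τ R : Type*) [CommSemiring R] :
    MvPowerSeries τ (MvPowerSeries σ R) →+* MvPowerSeries σ (MvPowerSeries τ R) where
  toFun := swapFun
  map_zero' := rfl
  map_add' F G := rfl
  map_one' := by
    classical
    ext a e
    rw [coeff_coeff_swapFun, MvPowerSeries.coeff_one, MvPowerSeries.coeff_one]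
    split_ifs <;> simp_all [MvPowerSeries.coeff_one]
  map_mul' F G := by
    classical
    ext a e
    rw [coeff_coeff_swapFun, MvPowerSeries.coeff_mul, MvPowerSeries.coeff_mul, map_sum, map_sum]
    simp only [MvPowerSeries.coeff_mul, coeff_coeff_swapFun]
    exact Finset.sum_comm

theorem coeff_coeff_swap [CommSemiring R] (F : MvPowerSeries τ (MvPowerSeries σ R)) (a : σ →₀ ℕ)
    (e : τ →₀ ℕ) : MvPowerSeries.coeff e (MvPowerSeries.coeff a (swap σ τ R F)) =
      MvPowerSeries.coeff a (MvPowerSeries.coeff e F) := rfl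

theorem swap_injective [CommSemiring R] : Function.Injective (swap σ τ R) := by
  intro F G h
  ext e a
  rw [← coeff_coeff_swap, h, coeff_coeff_swap]

theorem swap_map_C [CommSemiring R] (F : MvPowerSeries τ R) :
    swap σ τ R (MvPowerSeries.map MvPowerSeries.C F) = MvPowerSeries.C F := by
  classical
  ext a e
  rw [coeff_coeff_swap, MvPowerSeries.coeff_map, MvPowerSeries.coeff_C, MvPowerSeries.coeff_C]
  split_ifs <;> simp

theorem swap_C [CommSemiring R] (F : MvPowerSeries σ R) :
    swap σ τ R (MvPowerSeries.C F) = MvPowerSeries.map MvPowerSeries.C F := by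
  classical
  ext a e
  rw [coeff_coeff_swap, MvPowerSeries.coeff_map, MvPowerSeries.coeff_C, MvPowerSeries.coeff_C]
  split_ifs <;> simp

theorem pderiv_swap [CommSemiring R] (i : σ) (F : MvPowerSeries τ (MvPowerSeries σ R)) :
    MvPowerSeries.pderiv (MvPowerSeries τ R) i (swap σ τ R F) =
      swap σ τ R (coeffwise (MvPowerSeries.pderiv R i : _ →ₗ[R] _).toAddMonoidHom F) := by
  ext a e
  rw [MvPowerSeries.coeff_pderiv, coeff_coeff_swap, coeff_coeffwise]
  have : ((a i : MvPowerSeries τ R) + 1) = MvPowerSeries.C (a i + 1 : R) := by simp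
  rw [this, MvPowerSeries.coeff_mul_C, coeff_coeff_swap]
  exact (MvPowerSeries.coeff_pderiv _ _).symm

theorem pderiv_map [CommSemiring R] [CommSemiring S] (f : R →+* S) (i : σ)
    (F : MvPowerSeries σ R) : MvPowerSeries.pderiv S i (MvPowerSeries.map f F) =
      MvPowerSeries.map f (MvPowerSeries.pderiv R i F) := by
  ext a
  simp [MvPowerSeries.coeff_pderiv, MvPowerSeries.coeff_map]

end Coeffwise

/-! ### The chain rule for the exponential -/

theorem coeff_pow_eq_zero {σ R : Type*} [CommRing R] {f : MvPowerSeries σ R}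
    (hf : MvPowerSeries.constantCoeff f = 0) {n : ℕ} {e : σ →₀ ℕ} (h : e.degree < n) :
    MvPowerSeries.coeff e (f ^ n) = 0 := by
  apply MvPowerSeries.coeff_of_lt_order
  exact lt_of_lt_of_le (by exact_mod_cast h)
    (MvPowerSeries.le_order_pow_of_constantCoeff_eq_zero n hf)

section ExpOf

variable {k : Type*} [Field k] [Algebra ℂ k] {σ : Type*}

theorem coeff_expOf {f : MvPowerSeries σ k} (hf : MvPowerSeries.constantCoeff f = 0)
    {e : σ →₀ ℕ} {N : ℕ} (h : e.degree < N) :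
    MvPowerSeries.coeff e (expOf f) =
      MvPowerSeries.coeff e (∑ n ∈ Finset.range N, (n ! : k)⁻¹ • f ^ n) := by
  rw [expOf, PowerSeries.coeff_subst (PowerSeries.HasSubst.of_constantCoeff_zero hf),
    finsum_eq_sum_of_support_subset (s := Finset.range N), map_sum]
  · refine Finset.sum_congr rfl fun n _ => ?_
    rw [PowerSeries.coeff_exp, MvPowerSeries.coeff_smul, Algebra.smul_def]
    simp
  · intro n hn
    by_contra hN
    simp only [Finset.coe_range, Set.mem_Iio, not_lt] at hN
    exact hn (by simp [coeff_pow_eq_zero hf (h.trans_le hN)])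

theorem pderiv_expOf (i : σ) {f : MvPowerSeries σ k} (hf : MvPowerSeries.constantCoeff f = 0) :
    MvPowerSeries.pderiv k i (expOf f) = MvPowerSeries.pderiv k i f * expOf f := by
  classical
  have : CharZero k := charZero_of_injective_algebraMap (algebraMap ℂ k).injective
  ext e
  set N := e.degree + 1
  have key : MvPowerSeries.pderiv k i (∑ n ∈ Finset.range (N + 1), (n ! : k)⁻¹ • f ^ n) =
      MvPowerSeries.pderiv k i f * ∑ n ∈ Finset.range N, (n ! : k)⁻¹ • f ^ n := by
    rw [Finset.sum_range_succ', map_add, map_sum, Finset.mul_sum]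
    simp only [pow_zero, Derivation.map_smul, MvPowerSeries.pderiv_one, smul_zero, add_zero]
    refine Finset.sum_congr rfl fun n _ => ?_
    rw [MvPowerSeries.pderiv_pow, Nat.add_sub_cancel, Nat.factorial_succ]
    have h1 : ((n + 1 : ℕ) : MvPowerSeries σ k) = MvPowerSeries.C ((n + 1 : ℕ) : k) := by simp
    rw [h1, MvPowerSeries.smul_eq_C_mul, MvPowerSeries.smul_eq_C_mul]
    have h2 : (n ! : k)⁻¹ = (((n + 1) * n ! : ℕ) : k)⁻¹ * ((n + 1 : ℕ) : k) := by
      have : ((n + 1 : ℕ) : k) ≠ 0 := Nat.cast_ne_zero.2 n.succ_ne_zero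
      push_cast at this ⊢
      field_simp
    rw [h2, map_mul]
    ring
  have h3 : (e + Finsupp.single i 1).degree < N + 1 := by simp [N]
  rw [MvPowerSeries.coeff_pderiv, coeff_expOf hf h3, ← MvPowerSeries.coeff_pderiv, key,
    MvPowerSeries.coeff_mul, MvPowerSeries.coeff_mul]
  refine Finset.sum_congr rfl fun p hp => ?_
  rw [coeff_expOf hf (N := N)]
  have := Finset.HasAntidiagonal.mem_antidiagonal.1 hp
  simp only [N, ← this, map_add]
  omega

theorem expOf_zero : expOf (0 : MvPowerSeries σ k) = 1 := by
  rw [expOf, PowerSeries.subst_zero_eq_C_constantCoeff]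
  simp

theorem constantCoeff_expOf {f : MvPowerSeries σ k} (hf : MvPowerSeries.constantCoeff f = 0) :
    MvPowerSeries.constantCoeff (expOf f) = 1 := by
  rw [← MvPowerSeries.coeff_zero_eq_constantCoeff_apply, coeff_expOf hf (N := 1) (by simp)]
  simp

theorem expOf_mul_expOf_neg {f : MvPowerSeries σ k} (hf : MvPowerSeries.constantCoeff f = 0) :
    expOf f * expOf (-f) = 1 := by
  have : CharZero k := charZero_of_injective_algebraMap (algebraMap ℂ k).injective
  have hf' : MvPowerSeries.constantCoeff (-f) = 0 := by simp [hf]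
  apply MvPowerSeries.pderiv.ext
  · intro i
    rw [Derivation.leibniz, pderiv_expOf i hf, pderiv_expOf i hf', MvPowerSeries.pderiv_one,
      map_neg]
    simp only [smul_eq_mul]
    ring
  · rw [map_mul, constantCoeff_expOf hf, constantCoeff_expOf hf', map_one, mul_one]

end ExpOf

/-! ### Linear differential equations of first order -/

section ExpInt

open PowerSeries

variable {R S : Type*} [CommRing R] [CommRing S]

/-- The series `∑ (2k+1)!! u_k ξ^(2k)`, minus the logarithmic derivative of `vertex u`. -/
def weight (u : ℕ → R) : PowerSeries R :=
  PowerSeries.mk fun n => if Even n then ((n + 1)‼ : ℕ) * u (n / 2) else 0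

theorem weight_add (u v : ℕ → R) : weight (u + v) = weight u + weight v := by
  ext n
  simp only [weight, coeff_mk, map_add, Pi.add_apply]
  split_ifs <;> ring

theorem weight_neg (u : ℕ → R) : weight (-u) = -weight u := by
  ext n
  simp only [weight, coeff_mk, map_neg, Pi.neg_apply]
  split_ifs <;> ring

theorem map_weight (L : R →+* S) (u : ℕ → R) :
    PowerSeries.map L (weight u) = weight (fun k => L (u k)) := by
  ext n
  simp only [weight, coeff_mk, coeff_map]
  split_ifs <;> simp

theorem evalNegHom_weight (u : ℕ → R) : evalNegHom (weight u) = weight u := by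
  ext n
  simp only [evalNegHom, coeff_rescale, weight, coeff_mk]
  split_ifs with h
  · simp [h.neg_one_pow]
  · simp

theorem derivative_evalNegHom (F : PowerSeries R) :
    derivative R (evalNegHom F) = -evalNegHom (derivative R F) := by
  ext n
  simp only [evalNegHom, coeff_rescale, coeff_derivative, map_neg, pow_succ]
  ring

variable [Algebra ℚ R] [Algebra ℚ S]

/-- The primitive of a power series, without constant term. -/
def primitive (h : PowerSeries R) : PowerSeries R :=
  PowerSeries.mk fun n => (n : ℚ)⁻¹ • PowerSeries.coeff (n - 1) h

theorem constantCoeff_primitive (h : PowerSeries R) : constantCoeff (primitive h) = 0 := by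
  rw [← coeff_zero_eq_constantCoeff_apply, primitive, coeff_mk]
  simp

theorem derivative_primitive (h : PowerSeries R) : derivative R (primitive h) = h := by
  ext n
  rw [coeff_derivative, primitive, coeff_mk, Nat.add_sub_cancel, smul_mul_assoc]
  have h1 : ((n : R) + 1) = algebraMap ℚ R ((n + 1 : ℕ) : ℚ) := by simp
  have h2 : ((n + 1 : ℕ) : ℚ) ≠ 0 := Nat.cast_ne_zero.2 n.succ_ne_zero
  rw [h1, mul_comm, ← Algebra.smul_def, smul_smul, inv_mul_cancel₀ h2, one_smul]

/-- The power series `exp (∫ h)`, the solution of `Y' = h Y`, `Y(0) = 1`. -/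
def expInt (h : PowerSeries R) : PowerSeries R := (exp R).subst (primitive h)

theorem hasSubst_primitive (h : PowerSeries R) : HasSubst (primitive h) :=
  HasSubst.of_constantCoeff_zero' (constantCoeff_primitive h)

theorem derivative_expInt (h : PowerSeries R) : derivative R (expInt h) = h * expInt h := by
  rw [expInt, derivative_subst (hasSubst_primitive h), derivative_exp, derivative_primitive,
    mul_comm]

theorem constantCoeff_expInt (h : PowerSeries R) : constantCoeff (expInt h) = 1 := by
  have h1 := constantCoeff_subst_eq_zero (constantCoeff_primitive h) (exp R - 1) (by simp)
  rw [subst_sub (hasSubst_primitive h), map_sub, sub_eq_zero] at h1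
  rw [← coe_substAlgHom (hasSubst_primitive h), map_one, coe_substAlgHom, map_one] at h1
  exact h1

theorem expInt_mul_expInt_neg (h : PowerSeries R) : expInt h * expInt (-h) = 1 := by
  have : IsAddTorsionFree R := .of_module_rat R
  apply derivative.ext
  · rw [Derivation.leibniz, derivative_expInt, derivative_expInt, derivative_one]
    simp only [smul_eq_mul]
    ring
  · simp [constantCoeff_expInt]

theorem eq_expInt {h Y : PowerSeries R} (h0 : constantCoeff Y = 1)
    (h1 : derivative R Y = h * Y) : Y = expInt h := by
  have : IsAddTorsionFree R := .of_module_rat R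
  have h2 : Y * expInt (-h) = 1 := by
    apply derivative.ext
    · rw [Derivation.leibniz, derivative_expInt, h1, derivative_one]
      simp only [smul_eq_mul]
      ring
    · simp [constantCoeff_expInt, h0]
  calc Y = Y * (expInt h * expInt (-h)) := by rw [expInt_mul_expInt_neg, mul_one]
    _ = (Y * expInt (-h)) * expInt h := by ring
    _ = expInt h := by rw [h2, one_mul]

theorem expInt_add (g h : PowerSeries R) : expInt (g + h) = expInt g * expInt h := by
  symm
  apply eq_expInt
  · simp [constantCoeff_expInt]
  · rw [Derivation.leibniz, derivative_expInt, derivative_expInt]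
    simp only [smul_eq_mul]
    ring

theorem map_expInt (L : R →+* S) (h : PowerSeries R) :
    PowerSeries.map L (expInt h) = expInt (PowerSeries.map L h) := by
  apply eq_expInt
  · rw [← coeff_zero_eq_constantCoeff_apply, coeff_map, coeff_zero_eq_constantCoeff_apply,
      constantCoeff_expInt, map_one]
  · rw [← map_mul, ← derivative_expInt]
    ext n
    simp [coeff_derivative]

/-- The series `exp (-∑ (2k-1)!! u_k ξ^(2k+1))`. For `u_k = ∂/∂t_k` it is the operator of the shift
`t ↦ t - [ξ]`. -/
def vertex (u : ℕ → R) : PowerSeries R := expInt (-weight u)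

theorem vertex_add (u v : ℕ → R) : vertex (u + v) = vertex u * vertex v := by
  rw [vertex, vertex, vertex, weight_add, neg_add, expInt_add]

theorem vertex_mul_vertex_neg (u : ℕ → R) : vertex u * vertex (-u) = 1 := by
  rw [vertex, vertex, weight_neg, expInt_mul_expInt_neg]

theorem map_vertex (L : R →+* S) (u : ℕ → R) :
    PowerSeries.map L (vertex u) = vertex (fun k => L (u k)) := by
  rw [vertex, vertex, map_expInt, map_neg, map_weight]

theorem derivative_vertex (u : ℕ → R) : derivative R (vertex u) = -weight u * vertex u :=
  derivative_expInt _

theorem evalNegHom_vertex (u : ℕ → R) : evalNegHom (vertex u) = vertex (-u) := by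
  apply eq_expInt
  · rw [← coeff_zero_eq_constantCoeff_apply, evalNegHom, coeff_rescale, vertex]
    simp [constantCoeff_expInt]
  · rw [derivative_evalNegHom, derivative_vertex, map_mul, map_neg, evalNegHom_weight, weight_neg]
    ring

end ExpInt

/-! ### Differential operators in the times -/

theorem pderiv_comm {σ R : Type*} [CommSemiring R] (i j : σ) (F : MvPowerSeries σ R) :
    MvPowerSeries.pderiv R i (MvPowerSeries.pderiv R j F) =
      MvPowerSeries.pderiv R j (MvPowerSeries.pderiv R i F) := by
  classical
  ext a
  simp only [MvPowerSeries.coeff_pderiv]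
  rw [add_right_comm]
  by_cases h : i = j
  · subst h
    rfl
  · simp only [Finsupp.add_apply, Finsupp.single_apply, h, Ne.symm h, if_false, add_zero]
    ring

/-- Polynomials in the derivations `∂/∂t_k`, written as polynomials in variables `X k`. -/
abbrev DiffOp : Type := MvPolynomial ℕ ℂ

/-- The derivations `∂/∂t_k` as endomorphisms of the Fock space. -/
def partialEnd (k : ℕ) : Module.End ℂ Fock := (MvPowerSeries.pderiv ℂ k : Fock →ₗ[ℂ] Fock)

theorem partialEnd_comm : ∀ a ∈ Set.range partialEnd, ∀ b ∈ Set.range partialEnd,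
    a * b = b * a := by
  rintro _ ⟨i, rfl⟩ _ ⟨j, rfl⟩
  exact LinearMap.ext fun F => pderiv_comm i j F

/-- The commutative algebra generated by the derivations `∂/∂t_k`. -/
instance adjoinPartialEnd : CommRing (Algebra.adjoin ℂ (Set.range partialEnd)) :=
  { (Algebra.adjoin ℂ (Set.range partialEnd)).toRing with
    mul_comm := (Algebra.isMulCommutative_adjoin ℂ partialEnd_comm).is_comm.comm }

/-- The action of differential operators with constant coefficients on the Fock space. -/
def act : DiffOp →ₐ[ℂ] Module.End ℂ Fock :=
  (Algebra.adjoin ℂ (Set.range partialEnd)).val.comp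
    (MvPolynomial.aeval fun k => ⟨partialEnd k, Algebra.subset_adjoin ⟨k, rfl⟩⟩)

theorem act_X (k : ℕ) (F : Fock) : act (MvPolynomial.X k) F = MvPowerSeries.pderiv ℂ k F := by
  have h : act (MvPolynomial.X k) = partialEnd k := by
    rw [act, AlgHom.comp_apply, MvPolynomial.aeval_X]
    rfl
  rw [h]
  rfl

theorem act_mul (A B : DiffOp) (F : Fock) : act (A * B) F = act A (act B F) := by
  rw [map_mul]
  rfl

theorem act_X_mul (k : ℕ) (A : DiffOp) (F : Fock) :
    act (MvPolynomial.X k * A) F = MvPowerSeries.pderiv ℂ k (act A F) := by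
  rw [act_mul, act_X]

/-! ### The Miwa shift as a vertex operator -/

/-- Each coefficient of a substitution depends on finitely many coefficients only. -/
theorem exists_finset_coeff_subst {σ τ R S : Type*} [CommRing R] [CommRing S] [Algebra R S]
    {a : σ → MvPowerSeries τ S} (ha : MvPowerSeries.HasSubst a) (e : τ →₀ ℕ) :
    ∃ s : Finset (σ →₀ ℕ), ∀ F G : MvPowerSeries σ R,
      (∀ d ∈ s, MvPowerSeries.coeff d F = MvPowerSeries.coeff d G) →
      MvPowerSeries.coeff e (MvPowerSeries.subst a F) =
        MvPowerSeries.coeff e (MvPowerSeries.subst a G) := by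
  classical
  have hfin := MvPowerSeries.coeff_subst_finite ha (fun _ => 1 : MvPowerSeries σ R) e
  refine ⟨hfin.toFinset, fun F G h => ?_⟩
  rw [MvPowerSeries.coeff_subst ha, MvPowerSeries.coeff_subst ha]
  refine finsum_congr fun d => ?_
  by_cases hd : d ∈ hfin.toFinset
  · rw [h d hd]
  · have h1 : MvPowerSeries.coeff d (fun _ => 1 : MvPowerSeries σ R) = 1 := rfl
    have h2 : MvPowerSeries.coeff e (d.prod fun s n => a s ^ n) = 0 := by
      by_contra hne
      refine hd ((Set.Finite.mem_toFinset _).2 ?_)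
      rw [Function.mem_support, h1, one_smul]
      exact hne
    rw [h2, smul_zero, smul_zero]

/-- The chain rule for polynomials in infinitely many variables: the sum may be taken over any
sufficiently large finite set. -/
theorem pderiv_aeval {σ τ : Type*} (g : σ → MvPowerSeries τ ℂ) (i : τ) (p : MvPolynomial σ ℂ) :
    ∃ s : Finset σ, ∀ s', s ⊆ s' →
      MvPowerSeries.pderiv ℂ i (MvPolynomial.aeval g p) =
        ∑ k ∈ s', MvPolynomial.aeval g (MvPolynomial.pderiv k p) *
          MvPowerSeries.pderiv ℂ i (g k) := by
  classical
  induction p using MvPolynomial.induction_on with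
  | C a =>
    refine ⟨∅, fun s' _ => ?_⟩
    simp
  | add p q hp hq =>
    obtain ⟨s, hs⟩ := hp
    obtain ⟨t, ht⟩ := hq
    refine ⟨s ∪ t, fun s' h => ?_⟩
    rw [map_add, map_add, hs s' (Finset.union_subset_left h), ht s' (Finset.union_subset_right h),
      ← Finset.sum_add_distrib]
    refine Finset.sum_congr rfl fun k _ => ?_
    rw [map_add, map_add, add_mul]
  | mul_X p j hp =>
    obtain ⟨s, hs⟩ := hp
    refine ⟨insert j s, fun s' h => ?_⟩
    have hj : j ∈ s' := h (Finset.mem_insert_self j s)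
    rw [map_mul, MvPolynomial.aeval_X, Derivation.leibniz,
      hs s' ((Finset.subset_insert j s).trans h), smul_eq_mul, smul_eq_mul, Finset.mul_sum]
    have h1 : ∀ k, MvPolynomial.aeval g (MvPolynomial.pderiv k (p * MvPolynomial.X j)) *
        MvPowerSeries.pderiv ℂ i (g k) =
        (if k = j then MvPolynomial.aeval g p * MvPowerSeries.pderiv ℂ i (g j) else 0) +
          g j * (MvPolynomial.aeval g (MvPolynomial.pderiv k p) *
            MvPowerSeries.pderiv ℂ i (g k)) := by
      intro k
      rw [Derivation.leibniz, MvPolynomial.pderiv_X, Pi.single_apply]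
      by_cases hk : k = j
      · subst hk
        simp only [if_true, smul_eq_mul, map_add, map_mul, map_one, MvPolynomial.aeval_X]
        ring
      · rw [if_neg hk, if_neg (Ne.symm hk)]
        simp only [smul_eq_mul, map_add, map_mul, map_zero, MvPolynomial.aeval_X]
        ring
    rw [Finset.sum_congr rfl fun k _ => h1 k, Finset.sum_add_distrib, Finset.sum_ite_eq',
      if_pos hj]

theorem pderiv_miwaArg (k : ℕ) : MvPowerSeries.pderiv ℂ none (miwaArg k) =
    -(MvPowerSeries.monomial (Finsupp.single none (2 * k)) (((2 * k + 1)‼ : ℕ) : ℂ)) := by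
  have h : ((2 * k + 1)‼ : ℕ) = (2 * k + 1) * (2 * k - 1)‼ := by
    cases k with
    | zero => rfl
    | succ k => exact Nat.doubleFactorial_add_two (2 * k + 1)
  rw [miwaArg, map_sub, MvPowerSeries.pderiv_X_of_ne (by simp), zero_sub,
    ← MvPowerSeries.smul_eq_C_mul, Derivation.map_smul, MvPowerSeries.pderiv_pow,
    MvPowerSeries.pderiv_X_self, mul_one, Nat.add_sub_cancel, MvPowerSeries.X_pow_eq, h,
    MvPowerSeries.smul_eq_C_mul]
  have h2 : ((2 * k + 1 : ℕ) : MvPowerSeries (Option ℕ) ℂ) =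
      MvPowerSeries.C ((2 * k + 1 : ℕ) : ℂ) := (map_natCast _ _).symm
  rw [h2, ← mul_assoc, ← map_mul, ← MvPowerSeries.smul_eq_C_mul, ← map_smul, smul_eq_mul, mul_one,
    ← Nat.cast_mul, mul_comm (2 * k - 1)‼]

/-- The coefficient of `ξ^n` in `τ(t - [ξ])`. -/
def miwaCoeff (n : ℕ) (τ : Fock) : Fock := fun a =>
  MvPowerSeries.coeff (Finsupp.optionElim n a) (MvPowerSeries.subst miwaArg τ)

theorem coeff_miwaCoeff (n : ℕ) (τ : Fock) (a : ℕ →₀ ℕ) :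
    MvPowerSeries.coeff a (miwaCoeff n τ) =
      MvPowerSeries.coeff (Finsupp.optionElim n a) (MvPowerSeries.subst miwaArg τ) := rfl

theorem coeff_optionElim_mul_monomial (F : MvPowerSeries (Option ℕ) ℂ) (n m : ℕ) (a : ℕ →₀ ℕ)
    (c : ℂ) : MvPowerSeries.coeff (Finsupp.optionElim n a)
      (F * MvPowerSeries.monomial (Finsupp.single none m) c) =
      if m ≤ n then MvPowerSeries.coeff (Finsupp.optionElim (n - m) a) F * c else 0 := by
  classical
  rw [MvPowerSeries.coeff_mul_monomial]
  have h1 : Finsupp.single none m ≤ Finsupp.optionElim n a ↔ m ≤ n := by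
    rw [Finsupp.single_le_iff]
    simp
  have h2 : Finsupp.optionElim n a - Finsupp.single none m = Finsupp.optionElim (n - m) a := by
    ext x
    cases x <;> simp
  simp only [h1, h2]

theorem miwaCoeff_succ (n : ℕ) (τ : Fock) :
    ((n : ℂ) + 1) • miwaCoeff (n + 1) τ = -∑ p ∈ Finset.HasAntidiagonal.antidiagonal n,
      if Even p.1 then (((p.1 + 1)‼ : ℕ) : ℂ) •
        miwaCoeff p.2 (MvPowerSeries.pderiv ℂ (p.1 / 2) τ) else 0 := by
  classical
  ext a
  choose s hs using exists_finset_coeff_subst (R := ℂ) hasSubst_miwaArg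
  -- It suffices to treat a polynomial with the same relevant coefficients.
  set S : Finset (ℕ →₀ ℕ) := s (Finsupp.optionElim (n + 1) a) ∪
    (Finset.HasAntidiagonal.antidiagonal n).biUnion fun p =>
      (s (Finsupp.optionElim p.2 a)).image (· + Finsupp.single (p.1 / 2) 1) with hS
  set P : MvPolynomial ℕ ℂ := ∑ d ∈ S, MvPolynomial.monomial d (MvPowerSeries.coeff d τ) with hP
  have hPτ : ∀ d ∈ S, MvPowerSeries.coeff d τ = MvPowerSeries.coeff d (P : Fock) := by
    intro d hd
    rw [MvPolynomial.coeff_coe, hP, MvPolynomial.coeff_sum]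
    simp only [MvPolynomial.coeff_monomial, Finset.sum_ite_eq', if_pos hd]
  have e1 : MvPowerSeries.coeff a (miwaCoeff (n + 1) τ) =
      MvPowerSeries.coeff (Finsupp.optionElim (n + 1) a) (MvPolynomial.aeval miwaArg P) := by
    rw [coeff_miwaCoeff, ← MvPowerSeries.subst_coe]
    exact hs _ _ _ fun d hd => hPτ d (Finset.mem_union_left _ hd)
  have e2 : ∀ p ∈ Finset.HasAntidiagonal.antidiagonal n,
      MvPowerSeries.coeff a (miwaCoeff p.2 (MvPowerSeries.pderiv ℂ (p.1 / 2) τ)) =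
      MvPowerSeries.coeff (Finsupp.optionElim p.2 a)
        (MvPolynomial.aeval miwaArg (MvPolynomial.pderiv (p.1 / 2) P)) := by
    intro p hp
    rw [coeff_miwaCoeff, ← MvPowerSeries.subst_coe]
    refine hs _ _ _ fun d hd => ?_
    rw [← MvPowerSeries.pderiv_coe, MvPowerSeries.coeff_pderiv, MvPowerSeries.coeff_pderiv, hPτ]
    exact Finset.mem_union_right _ (Finset.mem_biUnion.2 ⟨p, hp, Finset.mem_image_of_mem _ hd⟩)
  obtain ⟨t, ht⟩ := pderiv_aeval miwaArg none P
  have hopt : Finsupp.optionElim (n + 1) a =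
      Finsupp.optionElim n a + Finsupp.single none 1 := by
    ext x
    cases x <;> simp
  have h3 := congrArg (MvPowerSeries.coeff (Finsupp.optionElim n a))
    (ht (t ∪ Finset.range (n + 1)) Finset.subset_union_left)
  rw [MvPowerSeries.coeff_pderiv, ← hopt, ← e1] at h3
  rw [MvPowerSeries.coeff_smul, map_neg, map_sum]
  simp only [Finsupp.optionElim_apply_none] at h3
  rw [mul_comm, h3, map_sum, Finset.Nat.sum_antidiagonal_eq_sum_range_succ_mk]
  simp only [pderiv_miwaArg, mul_neg, map_neg, Finset.sum_neg_distrib,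
    coeff_optionElim_mul_monomial]
  congr 1
  rw [← Finset.sum_filter, ← Finset.sum_filter_add_sum_filter_not (Finset.range n.succ) Even]
  rw [Finset.sum_eq_zero (s := Finset.filter (fun x => ¬ Even x) _), add_zero]
  · refine Finset.sum_bij (fun k _ => 2 * k) ?_ ?_ ?_ ?_
    · intro k hk
      simp only [Finset.mem_filter, Finset.mem_range] at hk ⊢
      exact ⟨by omega, even_two_mul k⟩
    · intro k _ l _ h
      exact Nat.eq_of_mul_eq_mul_left two_pos h
    · intro m hm
      simp only [Finset.mem_filter, Finset.mem_range] at hm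
      obtain ⟨k, rfl⟩ := even_iff_two_dvd.1 hm.2
      refine ⟨k, ?_, rfl⟩
      simp only [Finset.mem_filter, Finset.mem_union, Finset.mem_range]
      omega
    · intro k hk
      simp only [Finset.mem_filter] at hk
      have := e2 (2 * k, n - 2 * k) (Finset.HasAntidiagonal.mem_antidiagonal.2 (by simp; omega))
      simp only at this
      rw [if_pos (even_two_mul k), MvPowerSeries.coeff_smul, this, mul_comm,
        Nat.mul_div_cancel_left k two_pos]
  · intro m hm
    rw [if_neg (Finset.mem_filter.1 hm).2, map_zero]

theorem miwaCoeff_zero (τ : Fock) : miwaCoeff 0 τ = τ := by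
  classical
  ext a
  obtain ⟨s, hs⟩ := exists_finset_coeff_subst (R := ℂ) hasSubst_miwaArg (Finsupp.optionElim 0 a)
  set P : MvPolynomial ℕ ℂ := ∑ d ∈ insert a s,
    MvPolynomial.monomial d (MvPowerSeries.coeff d τ) with hP
  have hPτ : ∀ d ∈ insert a s, MvPowerSeries.coeff d τ = MvPowerSeries.coeff d (P : Fock) := by
    intro d hd
    rw [MvPolynomial.coeff_coe, hP, MvPolynomial.coeff_sum]
    simp only [MvPolynomial.coeff_monomial, Finset.sum_ite_eq', if_pos hd]
  have h1 : (MvPowerSeries.killCompl Function.Embedding.some).comp (MvPolynomial.aeval miwaArg) =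
      MvPolynomial.coeToMvPowerSeries.algHom ℂ := by
    refine MvPolynomial.algHom_ext fun k => ?_
    have h2 : MvPowerSeries.killCompl (R := ℂ) (Function.Embedding.some : ℕ ↪ Option ℕ)
        (MvPowerSeries.X none) = 0 := MvPowerSeries.killCompl_X_eq_zero (by simp)
    have h3 : MvPowerSeries.killCompl (R := ℂ) (Function.Embedding.some : ℕ ↪ Option ℕ)
        (MvPowerSeries.X (some k)) = MvPowerSeries.X k :=
      MvPowerSeries.killCompl_X (e := Function.Embedding.some) k
    rw [AlgHom.comp_apply, MvPolynomial.aeval_X, miwaArg, map_sub, map_mul, map_pow, h2, h3]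
    simp [MvPolynomial.coeToMvPowerSeries.algHom_apply]
  have h4 : Finsupp.optionElim 0 a = Finsupp.embDomain Function.Embedding.some a := by
    ext x
    cases x with
    | none => simp [Finsupp.embDomain_of_notMem_range]
    | some x =>
      rw [Finsupp.optionElim_apply_some]
      exact (Finsupp.embDomain_apply_self Function.Embedding.some a x).symm
  rw [coeff_miwaCoeff, hs τ P fun d hd => hPτ d (Finset.mem_insert_of_mem hd),
    MvPowerSeries.subst_coe, h4, ← MvPowerSeries.coeff_killCompl, ← AlgHom.comp_apply, h1,
    hPτ a (Finset.mem_insert_self a s)]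
  rfl

/-- The coefficients of the Miwa shift are those of the vertex operator
`exp (-∑ (2k-1)!! ξ^(2k+1) ∂/∂t_k)`. -/
theorem miwaCoeff_eq_act (n : ℕ) (τ : Fock) : miwaCoeff n τ =
    act (PowerSeries.coeff n (vertex (MvPolynomial.X : ℕ → DiffOp))) τ := by
  induction n using Nat.strong_induction_on generalizing τ with
  | _ n ih =>
  cases n with
  | zero =>
    rw [miwaCoeff_zero, PowerSeries.coeff_zero_eq_constantCoeff_apply, vertex,
      constantCoeff_expInt, map_one]
    rfl
  | succ n =>
    have hn : ((n : ℂ) + 1) ≠ 0 := by exact_mod_cast n.succ_ne_zero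
    have h1 := congrArg (PowerSeries.coeff n) (derivative_vertex (MvPolynomial.X : ℕ → DiffOp))
    rw [PowerSeries.coeff_derivative, neg_mul, map_neg, PowerSeries.coeff_mul] at h1
    have h2 := LinearMap.congr_fun (congrArg act h1) τ
    have h3 : (n : DiffOp) + 1 = algebraMap ℂ DiffOp ((n : ℂ) + 1) := by simp
    rw [h3, mul_comm, ← Algebra.smul_def, map_smul, LinearMap.smul_apply, map_neg,
      LinearMap.neg_apply, map_sum, LinearMap.sum_apply] at h2
    apply smul_right_injective Fock hn
    change ((n : ℂ) + 1) • _ = ((n : ℂ) + 1) • _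
    rw [h2, miwaCoeff_succ]
    congr 1
    refine Finset.sum_congr rfl fun p hp => ?_
    have hp2 : p.2 < n + 1 := by
      have := Finset.HasAntidiagonal.mem_antidiagonal.1 hp
      omega
    rw [weight, PowerSeries.coeff_mk]
    split_ifs with he
    · have h4 : (((p.1 + 1)‼ : ℕ) : DiffOp) = algebraMap ℂ DiffOp (((p.1 + 1)‼ : ℕ) : ℂ) := by simp
      rw [ih p.2 hp2, h4, mul_assoc, ← Algebra.smul_def, map_smul, LinearMap.smul_apply,
        mul_comm, act_mul, act_X]
    · rw [zero_mul, map_zero]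
      rfl

/-! ### Bilinear differential operators -/

/-- Bilinear differential operators with constant coefficients: `A ⊗ B` stands for the application
of `A` to a first and of `B` to a second factor. -/
def BiOp : Type := DiffOp ⊗[ℂ] DiffOp

instance : CommRing BiOp := inferInstanceAs (CommRing (DiffOp ⊗[ℂ] DiffOp))

instance : Algebra ℂ BiOp := inferInstanceAs (Algebra ℂ (DiffOp ⊗[ℂ] DiffOp))

instance : Algebra ℚ BiOp := ((algebraMap ℂ BiOp).comp (algebraMap ℚ ℂ)).toAlgebra

/-- The operators acting on the first factor. -/
def opL : DiffOp →ₐ[ℂ] BiOp :=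
  (Algebra.TensorProduct.includeLeft : DiffOp →ₐ[ℂ] DiffOp ⊗[ℂ] DiffOp)

/-- The operators acting on the second factor. -/
def opR : DiffOp →ₐ[ℂ] BiOp :=
  (Algebra.TensorProduct.includeRight : DiffOp →ₐ[ℂ] DiffOp ⊗[ℂ] DiffOp)

/-- The bilinear operator `A ⊗ B`. -/
def BiOp.mk (A B : DiffOp) : BiOp := A ⊗ₜ[ℂ] B

theorem BiOp.mk_eq (A B : DiffOp) : BiOp.mk A B = opL A * opR B := by
  have h : A ⊗ₜ[ℂ] B = (A ⊗ₜ[ℂ] (1 : DiffOp)) * ((1 : DiffOp) ⊗ₜ[ℂ] B) := by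
    rw [Algebra.TensorProduct.tmul_mul_tmul, one_mul, mul_one]
  exact h

theorem BiOp.opL_mul_mk (A B C : DiffOp) : opL C * BiOp.mk A B = BiOp.mk (C * A) B := by
  rw [BiOp.mk_eq, BiOp.mk_eq, map_mul, mul_assoc]

theorem BiOp.opR_mul_mk (A B C : DiffOp) : opR C * BiOp.mk A B = BiOp.mk A (C * B) := by
  rw [BiOp.mk_eq, BiOp.mk_eq, map_mul, mul_left_comm]

theorem BiOp.induction_on {P : BiOp → Prop} (C : BiOp) (hmk : ∀ A B, P (BiOp.mk A B))
    (hadd : ∀ C C', P C → P C' → P (C + C')) : P C := by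
  induction C using TensorProduct.induction_on with
  | zero =>
    have h := hmk 0 0
    rw [BiOp.mk_eq, map_zero, zero_mul] at h
    exact h
  | tmul A B => exact hmk A B
  | add C C' h h' => exact hadd C C' h h'

/-- The evaluation `A ↦ A τ` of differential operators at `τ`. -/
def evalAt (τ : Fock) : DiffOp →ₗ[ℂ] Fock := LinearMap.applyₗ τ ∘ₗ act.toLinearMap

theorem evalAt_apply (τ : Fock) (A : DiffOp) : evalAt τ A = act A τ := rfl

/-- The evaluation `A ⊗ B ↦ (A τ) (B τ)` of bilinear differential operators at `τ`. -/
def hirota (τ : Fock) : BiOp →ₗ[ℂ] Fock :=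
  TensorProduct.lift ((LinearMap.mul ℂ Fock).compl₁₂ (evalAt τ) (evalAt τ))

theorem hirota_mk (τ : Fock) (A B : DiffOp) :
    hirota τ (BiOp.mk A B) = evalAt τ A * evalAt τ B := rfl

/-- The derivative `z^(2k+1) / (2k+1)!!` of the phase with respect to `t_k`, a polynomial in `z`. -/
def phaseCoeff (k : ℕ) : Polynomial BiOp :=
  Polynomial.monomial (2 * k + 1) (algebraMap ℂ BiOp ((2 * k + 1)‼ : ℂ)⁻¹)

/-- The conjugation of bilinear operators by `exp (ϑ(z; t) - ϑ(z; t̃))`, with values in the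
polynomials in `z`: the derivations `∂/∂t_k` and `∂/∂t̃_k` become `∂/∂t_k + z^(2k+1) / (2k+1)!!` and
`∂/∂t̃_k - z^(2k+1) / (2k+1)!!`. -/
def conj : BiOp →ₐ[ℂ] Polynomial BiOp :=
  (Algebra.TensorProduct.productMap
    (MvPolynomial.aeval fun k => Polynomial.C (opL (MvPolynomial.X k)) + phaseCoeff k)
    (MvPolynomial.aeval fun k => Polynomial.C (opR (MvPolynomial.X k)) - phaseCoeff k) :
    DiffOp ⊗[ℂ] DiffOp →ₐ[ℂ] Polynomial BiOp)

theorem conj_opL_X (k : ℕ) : conj (opL (MvPolynomial.X k)) =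
    Polynomial.C (opL (MvPolynomial.X k)) + phaseCoeff k := by
  refine (Algebra.TensorProduct.productMap_apply_tmul _ _ _ _).trans ?_
  rw [map_one, mul_one, MvPolynomial.aeval_X]

theorem conj_opR_X (k : ℕ) : conj (opR (MvPolynomial.X k)) =
    Polynomial.C (opR (MvPolynomial.X k)) - phaseCoeff k := by
  refine (Algebra.TensorProduct.productMap_apply_tmul _ _ _ _).trans ?_
  rw [map_one, one_mul, MvPolynomial.aeval_X]

/-- The operator of the product `τ(t - [ξ]) τ(t̃ + [ξ])`. -/
def pairVertex : PowerSeries BiOp :=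
  PowerSeries.map opL.toRingHom (vertex MvPolynomial.X) *
    PowerSeries.map opR.toRingHom (vertex (-MvPolynomial.X))

/-- The coefficient of `z⁻¹` of a polynomial in `z` times `pairVertex` at `ξ = z⁻¹`. -/
def residue : Polynomial BiOp →ₗ[BiOp] BiOp :=
  Polynomial.lsum fun m => LinearMap.mulLeft BiOp (PowerSeries.coeff (m + 1) pairVertex)

theorem residue_monomial (m : ℕ) (c : BiOp) :
    residue (Polynomial.monomial m c) = PowerSeries.coeff (m + 1) pairVertex * c := by
  rw [residue, Polynomial.lsum_apply, Polynomial.sum_monomial_index _ _ (by simp)]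
  rfl

/-! ### The vertex operator and the expansion at infinity -/

/-- A series of differential operators, applied to `τ` coefficient by coefficient. -/
def evalSeries (τ : Fock) : PowerSeries DiffOp →+ PowerSeries Fock :=
  coeffwise (σ := Unit) (evalAt τ).toAddMonoidHom

theorem coeff_evalSeries (τ : Fock) (F : PowerSeries DiffOp) (n : ℕ) :
    PowerSeries.coeff n (evalSeries τ F) = evalAt τ (PowerSeries.coeff n F) := rfl

theorem miwaShift_eq (τ : Fock) :
    miwaShift τ = swap ℕ Unit ℂ (evalSeries τ (vertex MvPolynomial.X)) := by
  ext a n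
  rw [coeff_coeff_miwaShift, ← coeff_miwaCoeff, miwaCoeff_eq_act]
  rfl

theorem map_evalNegHom_swap (F : PowerSeries Fock) :
    MvPowerSeries.map (PowerSeries.evalNegHom (A := ℂ)) (swap ℕ Unit ℂ F) =
      swap ℕ Unit ℂ (PowerSeries.evalNegHom F) := by
  ext a n
  have h1 : PowerSeries.coeff n (MvPowerSeries.coeff a
      (swap ℕ Unit ℂ (PowerSeries.evalNegHom F))) =
      MvPowerSeries.coeff a (PowerSeries.coeff n (PowerSeries.evalNegHom F)) := rfl
  have h2 : PowerSeries.coeff n (MvPowerSeries.coeff a (swap ℕ Unit ℂ F)) =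
      MvPowerSeries.coeff a (PowerSeries.coeff n F) := rfl
  have h3 : ((-1 : Fock) ^ n) = MvPowerSeries.C ((-1) ^ n) := by simp
  rw [h1, MvPowerSeries.coeff_map, PowerSeries.evalNegHom, PowerSeries.evalNegHom,
    PowerSeries.coeff_rescale, PowerSeries.coeff_rescale, h2, h3, MvPowerSeries.coeff_C_mul]

theorem evalNegHom_evalSeries (τ : Fock) (F : PowerSeries DiffOp) :
    PowerSeries.evalNegHom (evalSeries τ F) = evalSeries τ (PowerSeries.evalNegHom F) := by
  ext1 n
  rw [coeff_evalSeries, PowerSeries.evalNegHom, PowerSeries.evalNegHom, PowerSeries.coeff_rescale,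
    PowerSeries.coeff_rescale, coeff_evalSeries]
  rcases neg_one_pow_eq_or DiffOp n with h | h
  · have h' : (-1 : Fock) ^ n = 1 := by
      rcases Nat.even_or_odd n with hn | hn
      · exact hn.neg_one_pow
      · rw [hn.neg_one_pow] at h
        have := congrArg (MvPolynomial.eval 0) h
        norm_num at this
    rw [h, h', one_mul, one_mul]
  · have h' : (-1 : Fock) ^ n = -1 := by
      rcases Nat.even_or_odd n with hn | hn
      · rw [hn.neg_one_pow] at h
        have := congrArg (MvPolynomial.eval 0) h
        norm_num at this
      · exact hn.neg_one_pow
    rw [h, h', neg_one_mul, neg_one_mul, map_neg]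

theorem shifted_eq {k : Type*} [Field k] [Algebra ℂ k] (τ : Fock) (ι : PowerSeries ℂ →+* k) :
    shifted τ ι = MvPowerSeries.map ι (swap ℕ Unit ℂ (evalSeries τ (vertex MvPolynomial.X))) := by
  rw [shifted, miwaShift_eq]

theorem shifted_neg_eq {k : Type*} [Field k] [Algebra ℂ k] (τ : Fock) (ι : PowerSeries ℂ →+* k) :
    shifted τ (neg ι) =
      MvPowerSeries.map ι (swap ℕ Unit ℂ (evalSeries τ (vertex (-MvPolynomial.X)))) := by
  rw [shifted_eq, neg, ← evalNegHom_vertex, ← evalNegHom_evalSeries, ← map_evalNegHom_swap]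
  rfl

/-! ### Derivatives of the bilinear integrand -/

theorem pderiv_phase {k : Type*} [Field k] (z : k) (j : ℕ) :
    MvPowerSeries.pderiv k j (phase z) =
      MvPowerSeries.C (z ^ (2 * j + 1) / ((2 * j + 1)‼ : ℕ)) := by
  classical
  ext a
  rw [MvPowerSeries.coeff_pderiv, MvPowerSeries.coeff_C]
  split_ifs with h
  · subst h
    rw [zero_add, coeff_single_phase]
    simp
  · rw [coeff_phase, Finset.sum_eq_zero, zero_mul]
    intro i _
    rw [if_neg]
    intro he
    have := congrArg Finsupp.degree he
    simp only [map_add, Finsupp.degree_single, add_eq_right, Finsupp.degree_eq_zero_iff] at this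
    exact h this

section RenameDerivative

variable {σ τ R : Type*} [CommRing R]

theorem pderiv_rename (f : σ ↪ τ) (i : σ) (F : MvPowerSeries σ R) :
    MvPowerSeries.pderiv R (f i) (MvPowerSeries.rename f F) =
      MvPowerSeries.rename f (MvPowerSeries.pderiv R i F) := by
  classical
  ext a
  rw [MvPowerSeries.coeff_pderiv]
  by_cases h : ∃ b, a = Finsupp.embDomain f b
  · obtain ⟨b, rfl⟩ := h
    have h1 : Finsupp.embDomain f b + Finsupp.single (f i) 1 =
        Finsupp.embDomain f (b + Finsupp.single i 1) := by
      rw [Finsupp.embDomain_eq_mapDomain, Finsupp.embDomain_eq_mapDomain, Finsupp.mapDomain_add,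
        Finsupp.mapDomain_single]
    rw [h1, MvPowerSeries.coeff_embDomain_rename, MvPowerSeries.coeff_embDomain_rename,
      MvPowerSeries.coeff_pderiv, Finsupp.embDomain_apply_self]
  · rw [MvPowerSeries.coeff_rename_eq_zero, MvPowerSeries.coeff_rename_eq_zero, zero_mul]
    · rintro ⟨b, rfl⟩
      exact h ⟨b, (Finsupp.embDomain_eq_mapDomain f b).symm⟩
    · rintro ⟨b, hb⟩
      refine h ⟨b - Finsupp.single i 1, ?_⟩
      ext x
      have hx := DFunLike.congr_fun hb x
      rw [← Finsupp.embDomain_eq_mapDomain, Finsupp.add_apply] at hx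
      by_cases hxr : x ∈ Set.range f
      · obtain ⟨y, rfl⟩ := hxr
        rw [Finsupp.embDomain_apply_self] at hx ⊢
        simp only [Finsupp.single_apply, f.injective.eq_iff, Finsupp.tsub_apply] at hx ⊢
        omega
      · rw [Finsupp.embDomain_of_notMem_range _ _ _ hxr] at hx ⊢
        omega

theorem pderiv_rename_eq_zero (f : σ ↪ τ) {j : τ} (hj : j ∉ Set.range f)
    (F : MvPowerSeries σ R) : MvPowerSeries.pderiv R j (MvPowerSeries.rename f F) = 0 := by
  classical
  ext a
  rw [MvPowerSeries.coeff_pderiv, MvPowerSeries.coeff_rename_eq_zero, zero_mul, map_zero]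
  rintro ⟨b, hb⟩
  have := DFunLike.congr_fun hb j
  rw [← Finsupp.embDomain_eq_mapDomain, Finsupp.embDomain_of_notMem_range _ _ _ hj] at this
  simp at this

end RenameDerivative

theorem pderiv_inT (k : ℕ) (F : MvPowerSeries ℕ (LaurentSeries ℂ)) :
    MvPowerSeries.pderiv _ (Sum.inl k) (inT F) = inT (MvPowerSeries.pderiv _ k F) :=
  pderiv_rename Function.Embedding.inl k F

theorem pderiv_inT' (k : ℕ) (F : MvPowerSeries ℕ (LaurentSeries ℂ)) :
    MvPowerSeries.pderiv _ (Sum.inr k) (inT' F) = inT' (MvPowerSeries.pderiv _ k F) :=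
  pderiv_rename Function.Embedding.inr k F

theorem pderiv_inr_inT (k : ℕ) (F : MvPowerSeries ℕ (LaurentSeries ℂ)) :
    MvPowerSeries.pderiv _ (Sum.inr k) (inT F) = 0 :=
  pderiv_rename_eq_zero Function.Embedding.inl (by simp) F

theorem pderiv_inl_inT' (k : ℕ) (F : MvPowerSeries ℕ (LaurentSeries ℂ)) :
    MvPowerSeries.pderiv _ (Sum.inl k) (inT' F) = 0 :=
  pderiv_rename_eq_zero Function.Embedding.inr (by simp) F

/-- The exponential factor `exp (ϑ(z; t) - ϑ(z; t̃))`. -/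
def expPhase : MvPowerSeries (ℕ ⊕ ℕ) (LaurentSeries ℂ) :=
  expOf (inT (phase (param expand)) - inT' (phase (param expand)))

theorem constantCoeff_phase_sub : MvPowerSeries.constantCoeff
    (inT (phase (param expand)) - inT' (phase (param expand))) = 0 := by
  rw [map_sub, inT, inT', MvPowerSeries.constantCoeff_rename, MvPowerSeries.constantCoeff_rename,
    sub_self]

/-- The value of `(∂/∂t_k) ϑ`. -/
def dPhase (k : ℕ) : LaurentSeries ℂ := param expand ^ (2 * k + 1) / ((2 * k + 1)‼ : ℕ)

theorem pderiv_inl_expPhase (k : ℕ) : MvPowerSeries.pderiv _ (Sum.inl k) expPhase =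
    MvPowerSeries.C (dPhase k) * expPhase := by
  rw [expPhase, pderiv_expOf _ constantCoeff_phase_sub, map_sub, pderiv_inT, pderiv_inl_inT',
    pderiv_phase, sub_zero, inT, MvPowerSeries.rename_C, dPhase]

theorem pderiv_inr_expPhase (k : ℕ) : MvPowerSeries.pderiv _ (Sum.inr k) expPhase =
    -(MvPowerSeries.C (dPhase k) * expPhase) := by
  rw [expPhase, pderiv_expOf _ constantCoeff_phase_sub, map_sub, pderiv_inr_inT, pderiv_inT',
    pderiv_phase, inT', MvPowerSeries.rename_C, dPhase]
  ring

/-- The embedding `ℂ[[t]][[ξ]] → ℂ((z⁻¹))[[t]]`. -/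
def atInfinity : PowerSeries Fock →+* MvPowerSeries ℕ (LaurentSeries ℂ) :=
  (MvPowerSeries.map expand).comp (swap ℕ Unit ℂ)

theorem pderiv_swap_evalSeries (k : ℕ) (τ : Fock) (F : PowerSeries DiffOp) :
    MvPowerSeries.pderiv (PowerSeries ℂ) k (swap ℕ Unit ℂ (evalSeries τ F)) =
      swap ℕ Unit ℂ (evalSeries τ (PowerSeries.C (MvPolynomial.X k) * F)) := by
  have h1 : coeffwise (MvPowerSeries.pderiv ℂ k : Fock →ₗ[ℂ] Fock).toAddMonoidHom
      (evalSeries τ F) = evalSeries τ (PowerSeries.C (MvPolynomial.X k) * F) := by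
    refine PowerSeries.ext fun n => ?_
    rw [coeff_evalSeries, PowerSeries.coeff_C_mul]
    exact (act_X_mul k _ τ).symm
  rw [← h1]
  exact pderiv_swap k (τ := Unit) (evalSeries τ F)

theorem pderiv_atInfinity_evalSeries (k : ℕ) (τ : Fock) (F : PowerSeries DiffOp) :
    MvPowerSeries.pderiv _ k (atInfinity (evalSeries τ F)) =
      atInfinity (evalSeries τ (PowerSeries.C (MvPolynomial.X k) * F)) := by
  rw [atInfinity, RingHom.comp_apply, pderiv_map, pderiv_swap_evalSeries, RingHom.comp_apply]

theorem inT_add (F G : MvPowerSeries ℕ (LaurentSeries ℂ)) : inT (F + G) = inT F + inT G :=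
  map_add _ _ _

theorem inT'_add (F G : MvPowerSeries ℕ (LaurentSeries ℂ)) : inT' (F + G) = inT' F + inT' G :=
  map_add _ _ _

theorem inT_C_mul (c : LaurentSeries ℂ) (F : MvPowerSeries ℕ (LaurentSeries ℂ)) :
    inT (MvPowerSeries.C c * F) = MvPowerSeries.C c * inT F := by
  rw [inT, map_mul, MvPowerSeries.rename_C, inT]

theorem inT'_C_mul (c : LaurentSeries ℂ) (F : MvPowerSeries ℕ (LaurentSeries ℂ)) :
    inT' (MvPowerSeries.C c * F) = MvPowerSeries.C c * inT' F := by
  rw [inT', map_mul, MvPowerSeries.rename_C, inT']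

/-- The complex constants in `ℂ((z⁻¹))`. -/
def laurentC (c : ℂ) : LaurentSeries ℂ := expand (PowerSeries.C c)

theorem coeff_laurentC_mul (c : ℂ) (f : LaurentSeries ℂ) (n : ℤ) :
    HahnSeries.coeff (laurentC c * f) n = c * HahnSeries.coeff f n := by
  rw [laurentC, expand, HahnSeries.ofPowerSeries_C, HahnSeries.C_mul_eq_smul,
    HahnSeries.coeff_smul, smul_eq_mul]

/-- The operator `A ↦ V A τ` for a series `V` of differential operators, expanded at infinity. -/
def expandedVertex (τ : Fock) (V : PowerSeries DiffOp) :
    DiffOp →+ MvPowerSeries ℕ (LaurentSeries ℂ) where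
  toFun A := atInfinity (evalSeries τ (PowerSeries.C A * V))
  map_zero' := by rw [map_zero, zero_mul, map_zero, map_zero]
  map_add' A B := by rw [map_add, add_mul, map_add, map_add]

theorem expandedVertex_apply (τ : Fock) (V : PowerSeries DiffOp) (A : DiffOp) :
    expandedVertex τ V A = atInfinity (evalSeries τ (PowerSeries.C A * V)) := rfl

theorem pderiv_expandedVertex (k : ℕ) (τ : Fock) (V : PowerSeries DiffOp) (A : DiffOp) :
    MvPowerSeries.pderiv _ k (expandedVertex τ V A) =
      expandedVertex τ V (MvPolynomial.X k * A) := by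
  rw [expandedVertex_apply, expandedVertex_apply, pderiv_atInfinity_evalSeries, ← mul_assoc,
    ← map_mul PowerSeries.C]

theorem expandedVertex_smul (τ : Fock) (V : PowerSeries DiffOp) (c : ℂ) (A : DiffOp) :
    expandedVertex τ V (c • A) = MvPowerSeries.C (laurentC c) * expandedVertex τ V A := by
  have h1 : evalSeries τ (PowerSeries.C (c • A) * V) =
      PowerSeries.C (MvPowerSeries.C c) * evalSeries τ (PowerSeries.C A * V) := by
    ext1 n
    rw [PowerSeries.coeff_C_mul, coeff_evalSeries, coeff_evalSeries, PowerSeries.coeff_C_mul,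
      PowerSeries.coeff_C_mul, smul_mul_assoc, map_smul, MvPowerSeries.smul_eq_C_mul]
  have h2 : atInfinity (PowerSeries.C (MvPowerSeries.C c)) = MvPowerSeries.C (laurentC c) := by
    have h3 : swap ℕ Unit ℂ (PowerSeries.C (MvPowerSeries.C c)) =
        MvPowerSeries.C (PowerSeries.C c) := by
      refine (swap_C (σ := ℕ) (τ := Unit) (MvPowerSeries.C c)).trans ?_
      exact MvPowerSeries.map_C _ _
    rw [atInfinity, RingHom.comp_apply, h3, MvPowerSeries.map_C, laurentC]
  rw [expandedVertex_apply, h1, map_mul, h2, expandedVertex_apply]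

/-- The operator `A ⊗ B`, applied to the two tau-functions in the bilinear integrand of index zero
but not to the exponential factor. -/
def integrandAt (τ : Fock) : BiOp →+ MvPowerSeries (ℕ ⊕ ℕ) (LaurentSeries ℂ) :=
  TensorProduct.liftAddHom
    (AddMonoidHom.mk' (fun A => AddMonoidHom.mk'
        (fun B => inT (expandedVertex τ (vertex MvPolynomial.X) A) *
          inT' (expandedVertex τ (vertex (-MvPolynomial.X)) B) * expPhase)
        fun B B' => by rw [map_add, inT'_add, mul_add, add_mul])
      fun A A' => by
        refine AddMonoidHom.ext fun B => ?_
        change inT (expandedVertex τ _ (A + A')) * inT' (expandedVertex τ _ B) * expPhase =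
          inT (expandedVertex τ _ A) * inT' (expandedVertex τ _ B) * expPhase +
            inT (expandedVertex τ _ A') * inT' (expandedVertex τ _ B) * expPhase
        rw [map_add, inT_add, add_mul, add_mul])
    fun c A B => by
      change inT (expandedVertex τ _ (c • A)) * inT' (expandedVertex τ _ B) * expPhase =
        inT (expandedVertex τ _ A) * inT' (expandedVertex τ _ (c • B)) * expPhase
      rw [expandedVertex_smul, expandedVertex_smul, inT_C_mul, inT'_C_mul]
      ring

theorem integrandAt_mk (τ : Fock) (A B : DiffOp) : integrandAt τ (BiOp.mk A B) =
    inT (expandedVertex τ (vertex MvPolynomial.X) A) *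
      inT' (expandedVertex τ (vertex (-MvPolynomial.X)) B) * expPhase := rfl

/-- Polynomials in `z` with coefficients in `BiOp`, applied to the bilinear integrand. -/
def integrand (τ : Fock) (q : Polynomial BiOp) : MvPowerSeries (ℕ ⊕ ℕ) (LaurentSeries ℂ) :=
  q.sum fun m c => MvPowerSeries.C (param expand ^ m) * integrandAt τ c

theorem integrand_monomial (τ : Fock) (m : ℕ) (c : BiOp) : integrand τ (Polynomial.monomial m c) =
    MvPowerSeries.C (param expand ^ m) * integrandAt τ c :=
  Polynomial.sum_monomial_index _ _ (by rw [map_zero, mul_zero])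

theorem integrand_add (τ : Fock) (p q : Polynomial BiOp) :
    integrand τ (p + q) = integrand τ p + integrand τ q :=
  Polynomial.sum_add_index p q _ (fun _ => by rw [map_zero, mul_zero])
    fun _ _ _ => by rw [map_add, mul_add]

theorem integrand_neg (τ : Fock) (p : Polynomial BiOp) :
    integrand τ (-p) = -integrand τ p := by
  have h := integrand_add τ (-p) p
  rw [neg_add_cancel, ← Polynomial.monomial_zero_right 0, integrand_monomial, map_zero,
    mul_zero] at h
  exact (neg_eq_of_add_eq_zero_left h.symm).symm

/-- An additive identity between `BiOp`-polynomials holds if it holds for elementary tensors. -/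
theorem polynomial_biOp_induction {P : Polynomial BiOp → Prop}
    (hadd : ∀ p q, P p → P q → P (p + q))
    (hmon : ∀ m A B, P (Polynomial.monomial m (BiOp.mk A B))) (q : Polynomial BiOp) : P q := by
  induction q using Polynomial.induction_on' with
  | add p q hp hq => exact hadd p q hp hq
  | monomial m c =>
    induction c using BiOp.induction_on with
    | hmk A B => exact hmon m A B
    | hadd x y hx hy =>
      rw [map_add]
      exact hadd _ _ hx hy

theorem integrand_monomial_mul (τ : Fock) (n : ℕ) (c : ℂ) (q : Polynomial BiOp) :
    integrand τ (Polynomial.monomial n (algebraMap ℂ BiOp c) * q) =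
      MvPowerSeries.C (param expand ^ n * laurentC c) * integrand τ q := by
  induction q using polynomial_biOp_induction with
  | hadd p q hp hq => rw [mul_add, integrand_add, integrand_add, hp, hq, mul_add]
  | hmon m A B =>
    rw [Polynomial.monomial_mul_monomial, ← opL.commutes c, BiOp.opL_mul_mk, ← Algebra.smul_def,
      integrand_monomial, integrand_monomial, integrandAt_mk, integrandAt_mk,
      expandedVertex_smul, inT_C_mul, pow_add, map_mul, map_mul]
    ring

theorem dPhase_eq (k : ℕ) :
    dPhase k = param expand ^ (2 * k + 1) * laurentC ((2 * k + 1)‼ : ℂ)⁻¹ := by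
  have h : ((2 * k + 1)‼ : ℂ) ≠ 0 := Nat.cast_ne_zero.2 (Nat.doubleFactorial_pos _).ne'
  have h1 : laurentC ((2 * k + 1)‼ : ℂ)⁻¹ * ((2 * k + 1)‼ : ℕ) = 1 := by
    have h2 : (((2 * k + 1)‼ : ℕ) : LaurentSeries ℂ) = laurentC ((2 * k + 1)‼ : ℂ) := by
      simp [laurentC]
    rw [h2, laurentC, laurentC, ← map_mul, ← map_mul, inv_mul_cancel₀ h, map_one, map_one]
  rw [dPhase, div_eq_iff (right_ne_zero_of_mul (h1.trans_ne one_ne_zero)), mul_assoc, h1, mul_one]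

theorem integrand_phaseCoeff_mul (τ : Fock) (k : ℕ) (q : Polynomial BiOp) :
    integrand τ (phaseCoeff k * q) = MvPowerSeries.C (dPhase k) * integrand τ q := by
  rw [phaseCoeff, integrand_monomial_mul, dPhase_eq]

theorem pderiv_inl_integrand (τ : Fock) (k : ℕ) (q : Polynomial BiOp) :
    MvPowerSeries.pderiv _ (Sum.inl k) (integrand τ q) =
      integrand τ (conj (opL (MvPolynomial.X k)) * q) := by
  rw [conj_opL_X, add_mul, integrand_add, integrand_phaseCoeff_mul]
  induction q using polynomial_biOp_induction with
  | hadd p q hp hq =>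
    rw [mul_add, integrand_add, integrand_add, map_add, hp, hq]
    ring
  | hmon m A B =>
    rw [Polynomial.C_mul_monomial, BiOp.opL_mul_mk,
      integrand_monomial, integrand_monomial, integrandAt_mk, integrandAt_mk,
      ← pderiv_expandedVertex]
    simp only [Derivation.leibniz, smul_eq_mul, MvPowerSeries.pderiv_C, pderiv_inT, pderiv_inl_inT',
      pderiv_inl_expPhase]
    ring

theorem pderiv_inr_integrand (τ : Fock) (k : ℕ) (q : Polynomial BiOp) :
    MvPowerSeries.pderiv _ (Sum.inr k) (integrand τ q) =
      integrand τ (conj (opR (MvPolynomial.X k)) * q) := by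
  rw [conj_opR_X, sub_mul, sub_eq_add_neg, integrand_add, integrand_neg, integrand_phaseCoeff_mul]
  induction q using polynomial_biOp_induction with
  | hadd p q hp hq =>
    rw [mul_add, integrand_add, integrand_add, map_add, hp, hq]
    ring
  | hmon m A B =>
    rw [Polynomial.C_mul_monomial, BiOp.opR_mul_mk,
      integrand_monomial, integrand_monomial, integrandAt_mk, integrandAt_mk,
      ← pderiv_expandedVertex]
    simp only [Derivation.leibniz, smul_eq_mul, MvPowerSeries.pderiv_C, pderiv_inr_inT, pderiv_inT',
      pderiv_inr_expPhase]
    ring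

theorem integrand_X_pow (τ : Fock) (p : ℕ) :
    integrand τ (Polynomial.X ^ (2 * p)) = bilinearIntegrand τ p := by
  rw [← Polynomial.monomial_one_right_eq_X_pow, integrand_monomial,
    show (1 : BiOp) = BiOp.mk 1 1 from rfl, integrandAt_mk, bilinearIntegrand, shifted_eq,
    shifted_neg_eq, expandedVertex_apply, expandedVertex_apply, map_one, one_mul, one_mul,
    atInfinity, RingHom.comp_apply, RingHom.comp_apply, mul_comm]
  rfl

/-! ### Restriction to the diagonal -/

/-- The series all of whose coefficients have no residue. -/
def residueFree (σ : Type*) : AddSubgroup (MvPowerSeries σ (LaurentSeries ℂ)) where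
  carrier := {F | ∀ d, HahnSeries.coeff (MvPowerSeries.coeff d F) 1 = 0}
  zero_mem' d := rfl
  add_mem' hF hG d := by
    rw [map_add, HahnSeries.coeff_add, hF d, hG d, add_zero]
  neg_mem' hF d := by
    rw [map_neg, HahnSeries.coeff_neg, hF d, neg_zero]

theorem C_laurentC_mul_mem_residueFree {σ : Type*} (c : ℂ) {F : MvPowerSeries σ (LaurentSeries ℂ)}
    (hF : F ∈ residueFree σ) : MvPowerSeries.C (laurentC c) * F ∈ residueFree σ := by
  intro d
  rw [MvPowerSeries.coeff_C_mul, coeff_laurentC_mul, hF d, mul_zero]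

theorem pderiv_mem_residueFree {σ : Type*} (i : σ) {F : MvPowerSeries σ (LaurentSeries ℂ)}
    (hF : F ∈ residueFree σ) : MvPowerSeries.pderiv _ i F ∈ residueFree σ := by
  intro d
  have h : ((d i : LaurentSeries ℂ) + 1) = laurentC (d i + 1) := by simp [laurentC]
  rw [MvPowerSeries.coeff_pderiv, h, mul_comm, coeff_laurentC_mul, hF, mul_zero]

theorem integrand_conj_mem {τ : Fock} (hτ : IsTauFunction τ) (p : ℕ) (C : BiOp) :
    integrand τ (conj C * Polynomial.X ^ (2 * p)) ∈ residueFree (ℕ ⊕ ℕ) := by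
  have hadd : ∀ C C' : BiOp, integrand τ (conj C * Polynomial.X ^ (2 * p)) ∈ residueFree (ℕ ⊕ ℕ) →
      integrand τ (conj C' * Polynomial.X ^ (2 * p)) ∈ residueFree (ℕ ⊕ ℕ) →
      integrand τ (conj (C + C') * Polynomial.X ^ (2 * p)) ∈ residueFree (ℕ ⊕ ℕ) := by
    intro C C' h h'
    rw [map_add, add_mul, integrand_add]
    exact add_mem h h'
  have hsmul : ∀ (c : ℂ) (C : BiOp),
      integrand τ (conj C * Polynomial.X ^ (2 * p)) ∈ residueFree (ℕ ⊕ ℕ) →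
      integrand τ (conj (algebraMap ℂ BiOp c * C) * Polynomial.X ^ (2 * p)) ∈
        residueFree (ℕ ⊕ ℕ) := by
    intro c C h
    have h1 : conj (algebraMap ℂ BiOp c) = Polynomial.monomial 0 (algebraMap ℂ BiOp c) :=
      conj.commutes c
    rw [map_mul, mul_assoc, h1, integrand_monomial_mul, pow_zero, one_mul]
    exact C_laurentC_mul_mem_residueFree c h
  have hL : ∀ A : DiffOp,
      integrand τ (conj (opL A) * Polynomial.X ^ (2 * p)) ∈ residueFree (ℕ ⊕ ℕ) := by
    intro A
    induction A using MvPolynomial.induction_on with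
    | C c =>
      have h1 : opL (MvPolynomial.C c) = algebraMap ℂ BiOp c * 1 := by
        rw [mul_one]
        exact opL.commutes c
      rw [h1]
      refine hsmul c 1 ?_
      rw [map_one, one_mul, integrand_X_pow]
      exact fun d => neg_eq_zero.1 (hτ p d)
    | add A B hA hB =>
      rw [map_add]
      exact hadd _ _ hA hB
    | mul_X A k hA =>
      rw [map_mul, mul_comm (opL A), map_mul, mul_assoc, ← pderiv_inl_integrand]
      exact pderiv_mem_residueFree _ hA
  have hR : ∀ (B : DiffOp) (C : BiOp),
      integrand τ (conj C * Polynomial.X ^ (2 * p)) ∈ residueFree (ℕ ⊕ ℕ) →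
      integrand τ (conj (opR B * C) * Polynomial.X ^ (2 * p)) ∈ residueFree (ℕ ⊕ ℕ) := by
    intro B C hC
    induction B using MvPolynomial.induction_on with
    | C c =>
      rw [show opR (MvPolynomial.C c) = algebraMap ℂ BiOp c from opR.commutes c]
      exact hsmul c C hC
    | add B B' hB hB' =>
      have h := hadd _ _ hB hB'
      rw [← add_mul, ← map_add opR] at h
      exact h
    | mul_X B k hB =>
      rw [mul_comm B, map_mul opR, mul_assoc, map_mul conj, mul_assoc, ← pderiv_inr_integrand]
      exact pderiv_mem_residueFree _ hB
  induction C using BiOp.induction_on with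
  | hadd C C' h h' => exact hadd C C' h h'
  | hmk A B =>
    rw [BiOp.mk_eq, mul_comm (opL A)]
    exact hR B _ (hL A)

instance tendstoCofinite_diagonal :
    Filter.TendstoCofinite (Sum.elim id id : ℕ ⊕ ℕ → ℕ) := by
  rw [Filter.tendstoCofinite_iff_finite_preimage_singleton]
  intro k
  refine (Set.toFinite {Sum.inl k, Sum.inr k}).subset ?_
  rintro (i | i) rfl <;> simp

/-- The restriction of a function of `t` and `t̃` to the diagonal `t̃ = t`. -/
def diagonal : MvPowerSeries (ℕ ⊕ ℕ) (LaurentSeries ℂ) →ₐ[LaurentSeries ℂ]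
    MvPowerSeries ℕ (LaurentSeries ℂ) :=
  MvPowerSeries.rename (Sum.elim id id)

theorem diagonal_inT (F : MvPowerSeries ℕ (LaurentSeries ℂ)) : diagonal (inT F) = F := by
  rw [diagonal, inT, MvPowerSeries.rename_rename]
  exact MvPowerSeries.rename_id_apply F

theorem diagonal_inT' (F : MvPowerSeries ℕ (LaurentSeries ℂ)) : diagonal (inT' F) = F := by
  rw [diagonal, inT', MvPowerSeries.rename_rename]
  exact MvPowerSeries.rename_id_apply F

theorem rename_expOf {σ τ k : Type*} [Field k] [Algebra ℂ k] (g : σ → τ)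
    [Filter.TendstoCofinite g] {f : MvPowerSeries σ k} (hf : MvPowerSeries.constantCoeff f = 0) :
    MvPowerSeries.rename g (expOf f) = expOf (MvPowerSeries.rename g f) := by
  ext e
  have hf' : MvPowerSeries.constantCoeff (MvPowerSeries.rename g f) = 0 := by
    rw [MvPowerSeries.constantCoeff_rename, hf]
  rw [coeff_expOf hf' (N := e.degree + 1) (Nat.lt_succ_self _), MvPowerSeries.coeff_rename]
  have h : ∑ n ∈ Finset.range (e.degree + 1), (n ! : k)⁻¹ • MvPowerSeries.rename g f ^ n =
      MvPowerSeries.rename g (∑ n ∈ Finset.range (e.degree + 1), (n ! : k)⁻¹ • f ^ n) := by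
    rw [map_sum]
    simp only [map_smul, map_pow]
  rw [h, MvPowerSeries.coeff_rename]
  refine Finset.sum_congr rfl fun x hx => ?_
  rw [coeff_expOf hf]
  have hx' : Finsupp.mapDomain g x = e := by simpa using hx
  rw [← hx', Finsupp.degree_mapDomain]
  exact Nat.lt_succ_self _

theorem diagonal_expPhase : diagonal expPhase = 1 := by
  have h := rename_expOf (Sum.elim id id : ℕ ⊕ ℕ → ℕ) constantCoeff_phase_sub
  have h1 : MvPowerSeries.rename (Sum.elim id id : ℕ ⊕ ℕ → ℕ)
      (inT (phase (param expand)) - inT' (phase (param expand))) = 0 := by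
    rw [map_sub, sub_eq_zero]
    exact (diagonal_inT _).trans (diagonal_inT' _).symm
  rw [h1, expOf_zero] at h
  exact h

theorem diagonal_mem_residueFree {F : MvPowerSeries (ℕ ⊕ ℕ) (LaurentSeries ℂ)}
    (hF : F ∈ residueFree (ℕ ⊕ ℕ)) : diagonal F ∈ residueFree ℕ := by
  intro d
  rw [diagonal, MvPowerSeries.coeff_rename]
  have h : ∀ s : Finset (ℕ ⊕ ℕ →₀ ℕ),
      HahnSeries.coeff (∑ x ∈ s, MvPowerSeries.coeff x F) 1 = 0 := by
    intro s
    induction s using Finset.cons_induction with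
    | empty => rfl
    | cons x s hx ih => rw [Finset.sum_cons, HahnSeries.coeff_add, ih, hF x, add_zero]
  exact h _

theorem coeff_param_pow_mul_expand (m : ℕ) (F : PowerSeries ℂ) :
    HahnSeries.coeff (param expand ^ m * expand F) 1 = PowerSeries.coeff (m + 1) F := by
  have h1 : param expand = HahnSeries.single (-1 : ℤ) (1 : ℂ) := by
    rw [param, expand, HahnSeries.ofPowerSeries_X, HahnSeries.inv_single, inv_one]
  have h2 : param expand ^ m = HahnSeries.single (-(m : ℤ)) (1 : ℂ) := by
    rw [h1, HahnSeries.single_pow]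
    simp
  have h3 : (1 : ℤ) = -(m : ℤ) + ((m + 1 : ℕ) : ℤ) := by
    push_cast
    ring
  rw [h2, h3, add_comm, HahnSeries.coeff_single_mul_add, one_mul, expand,
    HahnSeries.ofPowerSeries_apply_coeff]

theorem coeff_pairVertex_mul_mk (τ : Fock) (n : ℕ) (A B : DiffOp) :
    hirota τ (PowerSeries.coeff n pairVertex * BiOp.mk A B) =
      PowerSeries.coeff n (evalSeries τ (PowerSeries.C A * vertex MvPolynomial.X) *
        evalSeries τ (PowerSeries.C B * vertex (-MvPolynomial.X))) := by
  rw [pairVertex, PowerSeries.coeff_mul, PowerSeries.coeff_mul, Finset.sum_mul, map_sum]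
  refine Finset.sum_congr rfl fun p _ => ?_
  rw [PowerSeries.coeff_map, PowerSeries.coeff_map, mul_assoc]
  change hirota τ (opL _ * (opR _ * _)) = _
  rw [BiOp.opR_mul_mk, BiOp.opL_mul_mk, hirota_mk, coeff_evalSeries, coeff_evalSeries,
    PowerSeries.coeff_C_mul, PowerSeries.coeff_C_mul, mul_comm A, mul_comm B]

theorem coeff_diagonal_integrand (τ : Fock) (q : Polynomial BiOp) (d : ℕ →₀ ℕ) :
    HahnSeries.coeff (MvPowerSeries.coeff d (diagonal (integrand τ q))) 1 =
      MvPowerSeries.coeff d (hirota τ (residue q)) := by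
  induction q using polynomial_biOp_induction with
  | hadd p q hp hq =>
    rw [integrand_add, map_add, map_add, HahnSeries.coeff_add, hp, hq, map_add, map_add, map_add]
  | hmon m A B =>
    have h1 : diagonal (MvPowerSeries.C (param expand ^ m)) =
        MvPowerSeries.C (param expand ^ m) := MvPowerSeries.rename_C _ _
    rw [integrand_monomial, integrandAt_mk, map_mul diagonal, map_mul diagonal, map_mul diagonal,
      diagonal_inT, diagonal_inT',
      diagonal_expPhase, mul_one, h1, expandedVertex_apply, expandedVertex_apply,
      ← map_mul atInfinity,
      MvPowerSeries.coeff_C_mul, atInfinity, RingHom.comp_apply, MvPowerSeries.coeff_map,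
      coeff_param_pow_mul_expand, residue_monomial, coeff_pairVertex_mul_mk]
    rfl

/-- The Hirota identities in terms of bilinear differential operators: they follow from the
identities in `t` and `t̃` by applying `C` and restricting to the diagonal, where the exponential
factor is `1`. -/
theorem hirota_residue_conj {τ : Fock} (hτ : IsTauFunction τ) (p : ℕ) (C : BiOp) :
    hirota τ (residue (conj C * Polynomial.X ^ (2 * p))) = 0 := by
  ext d
  rw [← coeff_diagonal_integrand, diagonal_mem_residueFree (integrand_conj_mem hτ p C) d, map_zero]

/-! ### Generating series in two spectral parameters -/

section TwoVariables

variable {R S : Type*} [CommRing R] [CommRing S]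

/-- A power series `F(ξ)`, taken at `ξ = z⁻¹` for `i = 0` and at `ξ = w⁻¹` for `i = 1`. -/
def atVar (i : Fin 2) : PowerSeries R →+* MvPowerSeries (Fin 2) R :=
  (PowerSeries.toMvPowerSeries i).toRingHom

theorem atVar_X (i : Fin 2) : atVar i (PowerSeries.X : PowerSeries R) = MvPowerSeries.X i :=
  PowerSeries.toMvPowerSeries_X i

theorem atVar_C (i : Fin 2) (c : R) : atVar i (PowerSeries.C c) = MvPowerSeries.C c :=
  PowerSeries.toMvPowerSeries_C i c

theorem map_atVar (i : Fin 2) (f : R →+* S) (F : PowerSeries R) :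
    MvPowerSeries.map f (atVar i F) = atVar i (PowerSeries.map f F) :=
  (MvPowerSeries.rename_map _ f F).symm

theorem coeffwise_atVar (i : Fin 2) (L : R →+ S) (F : PowerSeries R) :
    coeffwise L (atVar i F) = atVar i (coeffwise (σ := Unit) L F : PowerSeries S) := by
  ext e
  rw [coeff_coeffwise]
  refine (congrArg L (MvPowerSeries.coeff_rename _ F e)).trans ?_
  refine Eq.trans ?_ (MvPowerSeries.coeff_rename (fun _ => i) (coeffwise L F) e).symm
  rw [map_sum]
  rfl

theorem coeff_atVar (i : Fin 2) (F : PowerSeries R) (e : Fin 2 →₀ ℕ) :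
    MvPowerSeries.coeff e (atVar i F) =
      if e = Finsupp.single i (e i) then PowerSeries.coeff (e i) F else 0 := by
  classical
  split_ifs with h
  · have h1 := MvPowerSeries.coeff_embDomain_rename (Function.Embedding.punit i) F
      (Finsupp.single () (e i))
    rw [Finsupp.embDomain_single] at h1
    refine Eq.trans ?_ h1
    exact congrArg (fun d => MvPowerSeries.coeff d (atVar i F)) h
  · refine MvPowerSeries.coeff_rename_eq_zero _ F ?_
    rintro ⟨b, rfl⟩
    apply h
    have hb : b = Finsupp.single () (b ()) := by
      ext
      simp
    rw [hb, Finsupp.mapDomain_single]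
    simp

theorem coeff_atVar_mul_atVar (F G : PowerSeries R) (e : Fin 2 →₀ ℕ) :
    MvPowerSeries.coeff e (atVar 0 F * atVar 1 G) =
      PowerSeries.coeff (e 0) F * PowerSeries.coeff (e 1) G := by
  classical
  have he : Finsupp.single 0 (e 0) + Finsupp.single 1 (e 1) = e := by
    ext i
    fin_cases i <;> simp
  rw [MvPowerSeries.coeff_mul,
    Finset.sum_eq_single (Finsupp.single 0 (e 0), Finsupp.single 1 (e 1))]
  · rw [coeff_atVar, coeff_atVar]
    simp
  · intro p hp hne
    rw [coeff_atVar, coeff_atVar]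
    split_ifs with h0 h1
    · exfalso
      apply hne
      have hp' := Finset.HasAntidiagonal.mem_antidiagonal.1 hp
      have e0 : e 0 = p.1 0 := by
        rw [← hp', Finsupp.add_apply, h1]
        simp
      have e1 : e 1 = p.2 1 := by
        rw [← hp', Finsupp.add_apply, h0]
        simp
      rw [e0, e1, ← h0, ← h1]
    · rw [mul_zero]
    · rw [zero_mul]
    · rw [zero_mul]
  · intro h
    exact absurd (Finset.HasAntidiagonal.mem_antidiagonal.2 he) h

end TwoVariables

/-! ### Kernels of the bilinear identities -/

section Kernels

open Polynomial

/-- The substitution `y = z^2` for polynomials with complex coefficients. -/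
def evenPoly : ℂ[X] →+* BiOp[X] :=
  Polynomial.eval₂RingHom (Polynomial.C.comp (algebraMap ℂ BiOp)) (X ^ 2)

theorem evenPoly_X : evenPoly X = X ^ 2 := Polynomial.eval₂_X _ _

theorem hirota_residue_conj_mul_evenPoly {τ : Fock} (hτ : IsTauFunction τ) (B : BiOp) (q : ℂ[X]) :
    hirota τ (residue (conj B * evenPoly q)) = 0 := by
  induction q using Polynomial.induction_on' with
  | add p q hp hq => rw [map_add evenPoly, mul_add, map_add, map_add, hp, hq, add_zero]
  | monomial p c =>
    have h1 : evenPoly (Polynomial.monomial p c) =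
        conj (algebraMap ℂ BiOp c) * X ^ (2 * p) := by
      rw [conj.commutes]
      refine (Polynomial.eval₂_monomial _ _).trans ?_
      rw [← pow_mul]
      rfl
    rw [h1, ← mul_assoc, ← map_mul, hirota_residue_conj hτ]

/-- The residue, coefficient by coefficient. -/
def residueSeries : MvPowerSeries (Fin 2) BiOp[X] →+ MvPowerSeries (Fin 2) BiOp :=
  coeffwise residue.toAddMonoidHom

/-- The evaluation of bilinear operators, coefficient by coefficient. -/
def hirotaSeries (τ : Fock) : MvPowerSeries (Fin 2) BiOp →+ MvPowerSeries (Fin 2) Fock :=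
  coeffwise (hirota τ).toAddMonoidHom

theorem residueSeries_map_C_mul (F : MvPowerSeries (Fin 2) BiOp)
    (K : MvPowerSeries (Fin 2) BiOp[X]) :
    residueSeries (MvPowerSeries.map Polynomial.C F * K) = F * residueSeries K := by
  refine (coeffwise_map_mul _ Polynomial.C (RingHom.id BiOp) (fun c x => ?_) F K).trans ?_
  · rw [← Polynomial.smul_eq_C_mul]
    exact residue.map_smul c x
  · rw [MvPowerSeries.map_id]
    rfl

theorem hirotaSeries_map_mul (τ : Fock) (F : MvPowerSeries (Fin 2) ℂ)
    (K : MvPowerSeries (Fin 2) BiOp) :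
    hirotaSeries τ (MvPowerSeries.map (algebraMap ℂ BiOp) F * K) =
      MvPowerSeries.map MvPowerSeries.C F * hirotaSeries τ K := by
  refine coeffwise_map_mul _ (algebraMap ℂ BiOp) MvPowerSeries.C (fun c x => ?_) F K
  rw [← Algebra.smul_def, ← MvPowerSeries.smul_eq_C_mul]
  exact (hirota τ).map_smul c x

theorem hirotaSeries_residueSeries_conj {τ : Fock} (hτ : IsTauFunction τ)
    (F : MvPowerSeries (Fin 2) BiOp) (E : MvPowerSeries (Fin 2) ℂ[X]) :
    hirotaSeries τ (residueSeries (MvPowerSeries.map conj.toRingHom F *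
      MvPowerSeries.map evenPoly E)) = 0 := by
  classical
  ext1 e
  rw [hirotaSeries, coeff_coeffwise, residueSeries, coeff_coeffwise, MvPowerSeries.coeff_mul,
    map_sum, map_sum, map_zero]
  refine Finset.sum_eq_zero fun p _ => ?_
  exact hirota_residue_conj_mul_evenPoly hτ _ _

/-- The expansion of `1 / (1 - z ξ)`. -/
def geom : PowerSeries BiOp[X] := PowerSeries.mk fun n => X ^ n

theorem one_sub_mul_geom : (1 - PowerSeries.C X * PowerSeries.X) * geom = 1 := by
  ext1 n
  cases n with
  | zero => simp [geom]
  | succ n =>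
    rw [sub_mul, one_mul, mul_assoc, map_sub, PowerSeries.coeff_C_mul, PowerSeries.coeff_succ_X_mul,
      geom, PowerSeries.coeff_mk, PowerSeries.coeff_mk, pow_succ', sub_self,
      PowerSeries.coeff_one, if_neg n.succ_ne_zero]

/-- The value of `exp (ϑ([ξ]; z))`, which is `((1 + z ξ) / (1 - z ξ))^(1/2)`. -/
def phaseKernel : PowerSeries BiOp[X] := vertex (-phaseCoeff)

/-- The even factor `(1 - y ξ^2)^(-1/2)`. -/
def evenFactor : PowerSeries ℂ[X] :=
  expInt (PowerSeries.mk fun n => if Even n then 0 else X ^ ((n + 1) / 2))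

theorem weight_phaseCoeff :
    weight phaseCoeff = PowerSeries.mk fun n => if Even n then X ^ (n + 1) else 0 := by
  ext1 n
  rw [weight, PowerSeries.coeff_mk, PowerSeries.coeff_mk]
  split_ifs with h
  · obtain ⟨k, rfl⟩ := even_iff_two_dvd.1 h
    rw [Nat.mul_div_cancel_left k two_pos, phaseCoeff]
    have h1 : (((2 * k + 1)‼ : ℕ) : BiOp[X]) =
        Polynomial.C (algebraMap ℂ BiOp ((2 * k + 1)‼ : ℂ)) := by simp
    have h2 : ((2 * k + 1)‼ : ℂ) ≠ 0 := Nat.cast_ne_zero.2 (Nat.doubleFactorial_pos _).ne'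
    rw [h1, Polynomial.C_mul_monomial, ← map_mul, mul_inv_cancel₀ h2, map_one,
      Polynomial.monomial_one_right_eq_X_pow]
  · rfl

/-- Up to a factor that is even in `z`, the phase factor is `1 / (1 - z ξ)`. -/
theorem evenFactor_mul_phaseKernel :
    PowerSeries.map evenPoly evenFactor * phaseKernel = geom := by
  rw [evenFactor, map_expInt, phaseKernel, vertex, weight_neg, neg_neg, ← expInt_add,
    weight_phaseCoeff]
  symm
  apply eq_expInt
  · simp [geom]
  · have h1 : PowerSeries.map evenPoly
        (PowerSeries.mk fun n => if Even n then 0 else X ^ ((n + 1) / 2)) +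
        (PowerSeries.mk fun n => if Even n then X ^ (n + 1) else 0) =
        PowerSeries.mk fun n => (X : BiOp[X]) ^ (n + 1) := by
      ext1 n
      rw [map_add, PowerSeries.coeff_map, PowerSeries.coeff_mk, PowerSeries.coeff_mk,
        PowerSeries.coeff_mk]
      split_ifs with h
      · rw [map_zero, zero_add]
      · have h2 : 2 * ((n + 1) / 2) = n + 1 :=
          Nat.mul_div_cancel' (even_iff_two_dvd.1 (Nat.even_add_one.2 h))
        rw [map_pow, evenPoly_X, ← pow_mul, h2, add_zero]
    rw [h1]
    ext1 n
    rw [PowerSeries.coeff_derivative, PowerSeries.coeff_mul, geom, PowerSeries.coeff_mk]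
    simp only [PowerSeries.coeff_mk]
    rw [Finset.sum_congr rfl (g := fun _ => (X : BiOp[X]) ^ (n + 1)), Finset.sum_const,
      Finset.Nat.card_antidiagonal, nsmul_eq_mul]
    · push_cast
      ring
    · intro p hp
      rw [← pow_add, ← Finset.HasAntidiagonal.mem_antidiagonal.1 hp]
      congr 1
      omega

/-- The bilinear identities for a shift by two arguments, in which the phase has been replaced by
`1 / ((1 - z ξ_i) (1 - z ξ_j))`. -/
theorem hirotaSeries_kernel {τ : Fock} (hτ : IsTauFunction τ) {i j : Fin 2}
    {W : MvPowerSeries (Fin 2) BiOp}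
    (hW : MvPowerSeries.map conj.toRingHom W =
      MvPowerSeries.map Polynomial.C W * (atVar i phaseKernel * atVar j phaseKernel))
    (T : MvPowerSeries (Fin 2) BiOp) (E : MvPowerSeries (Fin 2) ℂ[X]) :
    hirotaSeries τ (W * residueSeries (MvPowerSeries.map conj.toRingHom T *
      MvPowerSeries.map evenPoly E * (atVar i geom * atVar j geom))) = 0 := by
  have h := hirotaSeries_residueSeries_conj hτ (T * W)
    (E * (atVar i evenFactor * atVar j evenFactor))
  rw [map_mul (MvPowerSeries.map conj.toRingHom), hW, map_mul (MvPowerSeries.map evenPoly),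
    map_mul (MvPowerSeries.map evenPoly), map_atVar, map_atVar] at h
  have h1 := fun k => congrArg (atVar k) evenFactor_mul_phaseKernel
  simp only [map_mul] at h1
  rw [← residueSeries_map_C_mul, ← h1, ← h1]
  refine Eq.trans (congrArg _ (congrArg _ ?_)) h
  ring

end Kernels

/-! ### Bilinear identities with shifted arguments -/

section Identities

open Polynomial

/-- Series of operators acting on the first factor. -/
def seriesL : MvPowerSeries (Fin 2) DiffOp →+* MvPowerSeries (Fin 2) BiOp :=
  MvPowerSeries.map opL.toRingHom

/-- Series of operators acting on the second factor. -/
def seriesR : MvPowerSeries (Fin 2) DiffOp →+* MvPowerSeries (Fin 2) BiOp :=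
  MvPowerSeries.map opR.toRingHom

/-- The operator `τ ↦ τ(t - [ξ_i])`. -/
def shiftOp (i : Fin 2) : MvPowerSeries (Fin 2) DiffOp := atVar i (vertex MvPolynomial.X)

/-- The operator `τ ↦ τ(t + [ξ_i])`. -/
def unshiftOp (i : Fin 2) : MvPowerSeries (Fin 2) DiffOp := atVar i (vertex (-MvPolynomial.X))

/-- The insertion operator `∑_k (2k+1)!! ξ_i^(2k+2) ∂/∂t_k`. -/
def insertOp (i : Fin 2) : MvPowerSeries (Fin 2) DiffOp :=
  atVar i (PowerSeries.X ^ 2 * weight MvPolynomial.X)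

/-- The derivation `∂/∂x`. -/
def dxOp : MvPowerSeries (Fin 2) DiffOp := MvPowerSeries.C (MvPolynomial.X 0)

/-- A series of differential operators in two variables, applied to `τ`. -/
def evalSeries₂ (τ : Fock) : MvPowerSeries (Fin 2) DiffOp →+ MvPowerSeries (Fin 2) Fock :=
  coeffwise (evalAt τ).toAddMonoidHom

theorem shiftOp_mul_unshiftOp (i : Fin 2) : shiftOp i * unshiftOp i = 1 := by
  rw [shiftOp, unshiftOp, ← map_mul (atVar i), vertex_mul_vertex_neg, map_one]

theorem hirotaSeries_seriesL_mul_seriesR (τ : Fock) (F G : MvPowerSeries (Fin 2) DiffOp) :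
    hirotaSeries τ (seriesL F * seriesR G) = evalSeries₂ τ F * evalSeries₂ τ G := by
  classical
  ext1 e
  rw [hirotaSeries, coeff_coeffwise, MvPowerSeries.coeff_mul, MvPowerSeries.coeff_mul, map_sum]
  refine Finset.sum_congr rfl fun p _ => ?_
  refine Eq.trans ?_ (hirota_mk τ _ _)
  rw [BiOp.mk_eq]
  rfl

theorem phaseCoeff_zero : phaseCoeff 0 = X := by
  rw [phaseCoeff]
  simp [Polynomial.X]

/-- Conjugation multiplies a vertex operator in `t̃` by the phase factor. -/
theorem map_conj_vertex_opR : PowerSeries.map conj.toRingHom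
    (PowerSeries.map opR.toRingHom (vertex MvPolynomial.X)) =
      PowerSeries.map Polynomial.C (PowerSeries.map opR.toRingHom (vertex MvPolynomial.X)) *
        phaseKernel := by
  rw [map_vertex, map_vertex, map_vertex, phaseKernel, ← vertex_add]
  congr 1
  ext1 k
  exact (conj_opR_X k).trans (sub_eq_add_neg _ _)

/-- Conjugation multiplies an inverse vertex operator in `t` by the phase factor. -/
theorem map_conj_vertex_opL : PowerSeries.map conj.toRingHom
    (PowerSeries.map opL.toRingHom (vertex (-MvPolynomial.X))) =
      PowerSeries.map Polynomial.C (PowerSeries.map opL.toRingHom (vertex (-MvPolynomial.X))) *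
        phaseKernel := by
  rw [map_vertex, map_vertex, map_vertex, phaseKernel, ← vertex_add]
  congr 1
  ext1 k
  have h := congrArg Neg.neg (conj_opL_X k)
  rw [neg_add] at h
  refine Eq.trans ?_ (h.trans ?_)
  · exact (congrArg conj (map_neg opL _)).trans (map_neg conj _)
  · refine congrArg (· + -phaseCoeff k) ?_
    exact ((congrArg Polynomial.C (map_neg opL _)).trans (map_neg Polynomial.C _)).symm

theorem map_conj_seriesR_shiftOp (i : Fin 2) :
    MvPowerSeries.map conj.toRingHom (seriesR (shiftOp i)) =
      MvPowerSeries.map Polynomial.C (seriesR (shiftOp i)) * atVar i phaseKernel := by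
  rw [seriesR, shiftOp, map_atVar, map_atVar, map_conj_vertex_opR, map_mul (atVar i), map_atVar]

theorem map_conj_seriesL_unshiftOp (i : Fin 2) :
    MvPowerSeries.map conj.toRingHom (seriesL (unshiftOp i)) =
      MvPowerSeries.map Polynomial.C (seriesL (unshiftOp i)) * atVar i phaseKernel := by
  rw [seriesL, unshiftOp, map_atVar, map_atVar, map_conj_vertex_opL, map_mul (atVar i), map_atVar]

theorem map_conj_seriesR_dxOp : MvPowerSeries.map conj.toRingHom (seriesR dxOp) =
    MvPowerSeries.map Polynomial.C (seriesR dxOp) - MvPowerSeries.C X := by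
  rw [seriesR, dxOp, MvPowerSeries.map_C, MvPowerSeries.map_C, MvPowerSeries.map_C,
    ← map_sub MvPowerSeries.C]
  refine congrArg _ ((conj_opR_X 0).trans ?_)
  rw [phaseCoeff_zero]
  rfl

theorem map_conj_seriesL_dxOp : MvPowerSeries.map conj.toRingHom (seriesL dxOp) =
    MvPowerSeries.map Polynomial.C (seriesL dxOp) + MvPowerSeries.C X := by
  rw [seriesL, dxOp, MvPowerSeries.map_C, MvPowerSeries.map_C, MvPowerSeries.map_C,
    ← map_add MvPowerSeries.C]
  refine congrArg _ ((conj_opL_X 0).trans ?_)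
  rw [phaseCoeff_zero]
  rfl

/-! ### Residues of elementary kernels -/

theorem one_sub_mul_atVar_geom (i : Fin 2) :
    (1 - MvPowerSeries.C X * MvPowerSeries.X i) * atVar i geom = 1 := by
  have h := congrArg (atVar i) one_sub_mul_geom
  rwa [map_mul (atVar i), map_sub (atVar i), map_mul (atVar i), atVar_C, atVar_X,
    map_one (atVar i)] at h

theorem residueSeries_atVar (i : Fin 2) (F : PowerSeries BiOp[X]) :
    residueSeries (atVar i F) =
      atVar i (PowerSeries.mk fun n => residue (PowerSeries.coeff n F)) := by
  rw [residueSeries, coeffwise_atVar]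
  refine congrArg (atVar i) (PowerSeries.ext fun n => ?_)
  rw [PowerSeries.coeff_mk]
  rfl

theorem residue_X_pow (n : ℕ) : residue (X ^ n) = PowerSeries.coeff (n + 1) pairVertex := by
  rw [← Polynomial.monomial_one_right_eq_X_pow, residue_monomial, mul_one]

theorem constantCoeff_pairVertex : PowerSeries.constantCoeff pairVertex = 1 := by
  rw [pairVertex, map_mul, map_vertex, map_vertex, vertex, vertex, constantCoeff_expInt,
    constantCoeff_expInt, one_mul]

theorem atVar_pairVertex (i : Fin 2) :
    atVar i pairVertex = seriesL (shiftOp i) * seriesR (unshiftOp i) := by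
  rw [pairVertex, map_mul (atVar i), seriesL, seriesR, shiftOp, unshiftOp, map_atVar, map_atVar]

theorem X_mul_residueSeries_geom (i : Fin 2) :
    MvPowerSeries.X i * residueSeries (atVar i geom) =
      seriesL (shiftOp i) * seriesR (unshiftOp i) - 1 := by
  rw [residueSeries_atVar, ← atVar_X, ← atVar_pairVertex, ← map_mul (atVar i),
    ← map_one (atVar i), ← map_sub (atVar i)]
  congr 1
  ext1 n
  cases n with
  | zero => simp [constantCoeff_pairVertex]
  | succ n =>
    rw [PowerSeries.coeff_succ_X_mul, PowerSeries.coeff_mk, geom, PowerSeries.coeff_mk,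
      residue_X_pow, map_sub, PowerSeries.coeff_one, if_neg n.succ_ne_zero, sub_zero]

theorem map_vertex_neg {R S : Type*} [CommRing R] [Algebra ℚ R] [CommRing S] [Algebra ℚ S]
    (L : R →+* S) (u : ℕ → R) :
    PowerSeries.map L (vertex (-u)) = vertex (-fun k => L (u k)) := by
  rw [map_vertex]
  congr 1
  ext1 k
  exact map_neg L _

theorem derivative_pairVertex : PowerSeries.derivative BiOp pairVertex =
    (PowerSeries.map opR.toRingHom (weight MvPolynomial.X) -
      PowerSeries.map opL.toRingHom (weight MvPolynomial.X)) * pairVertex := by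
  rw [pairVertex, Derivation.leibniz, map_vertex, map_vertex_neg, derivative_vertex,
    derivative_vertex, map_weight, map_weight, weight_neg, smul_eq_mul, smul_eq_mul]
  ring

theorem X_sq_mul_residueSeries_geom_sq (i : Fin 2) :
    MvPowerSeries.X i ^ 2 * residueSeries (atVar i geom * atVar i geom) =
      (seriesR (insertOp i) - seriesL (insertOp i)) *
        (seriesL (shiftOp i) * seriesR (unshiftOp i)) := by
  have h1 : PowerSeries.mk (fun n => residue (PowerSeries.coeff n (geom * geom))) =
      PowerSeries.derivative BiOp pairVertex := by
    ext1 n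
    rw [PowerSeries.coeff_mk, PowerSeries.coeff_derivative, PowerSeries.coeff_mul,
      Finset.sum_congr rfl (g := fun _ => (X : BiOp[X]) ^ n), Finset.sum_const,
      Finset.Nat.card_antidiagonal, map_nsmul, residue_X_pow, nsmul_eq_mul, mul_comm]
    · push_cast
      ring
    · intro p hp
      rw [geom, PowerSeries.coeff_mk, PowerSeries.coeff_mk, ← pow_add,
        Finset.HasAntidiagonal.mem_antidiagonal.1 hp]
  rw [← map_mul (atVar i), residueSeries_atVar, h1, derivative_pairVertex, map_mul (atVar i),
    map_sub (atVar i), atVar_pairVertex, insertOp, seriesR, seriesL, map_atVar, map_atVar,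
    map_mul (PowerSeries.map opR.toRingHom), map_mul (PowerSeries.map opL.toRingHom),
    map_mul (atVar i), map_mul (atVar i), map_pow, map_pow, map_pow, map_pow, PowerSeries.map_X,
    PowerSeries.map_X, atVar_X]
  ring

/-- The expansion of `1 / (1 + z ξ)`. -/
def negGeom : PowerSeries BiOp[X] := PowerSeries.mk fun n => (-X) ^ n

theorem one_add_mul_atVar_negGeom (i : Fin 2) :
    (1 + MvPowerSeries.C X * MvPowerSeries.X i) * atVar i negGeom = 1 := by
  rw [← atVar_X, ← atVar_C, ← map_mul (atVar i), ← map_one (atVar i), ← map_add (atVar i),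
    ← map_mul (atVar i)]
  congr 1
  ext1 n
  cases n with
  | zero => simp [negGeom]
  | succ n =>
    rw [add_mul, one_mul, mul_assoc, map_add, PowerSeries.coeff_C_mul, PowerSeries.coeff_succ_X_mul,
      negGeom, PowerSeries.coeff_mk, PowerSeries.coeff_mk, pow_succ', PowerSeries.coeff_one,
      if_neg n.succ_ne_zero]
    ring

theorem evalNegHom_pairVertex : PowerSeries.evalNegHom pairVertex =
    PowerSeries.map opL.toRingHom (vertex (-MvPolynomial.X)) *
      PowerSeries.map opR.toRingHom (vertex MvPolynomial.X) := by
  rw [pairVertex, map_mul, map_vertex_neg, map_vertex_neg, map_vertex, map_vertex,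
    evalNegHom_vertex, evalNegHom_vertex, neg_neg]

theorem X_mul_residueSeries_negGeom (i : Fin 2) :
    MvPowerSeries.X i * residueSeries (atVar i negGeom) =
      1 - seriesL (unshiftOp i) * seriesR (shiftOp i) := by
  have h0 : seriesL (unshiftOp i) * seriesR (shiftOp i) =
      atVar i (PowerSeries.evalNegHom pairVertex) := by
    rw [evalNegHom_pairVertex, map_mul (atVar i), seriesL, seriesR, shiftOp, unshiftOp, map_atVar,
      map_atVar]
  rw [residueSeries_atVar, ← atVar_X, h0, ← map_mul (atVar i),
    ← map_one (atVar i), ← map_sub (atVar i)]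
  congr 1
  ext1 n
  cases n with
  | zero =>
    rw [map_sub, PowerSeries.evalNegHom, PowerSeries.coeff_rescale, pow_zero, one_mul,
      PowerSeries.coeff_zero_eq_constantCoeff_apply, PowerSeries.coeff_zero_eq_constantCoeff_apply,
      PowerSeries.coeff_zero_eq_constantCoeff_apply, constantCoeff_pairVertex]
    simp
  | succ n =>
    have h1 : (-X : BiOp[X]) ^ n = (-1 : BiOp) ^ n • X ^ n := by
      rw [neg_pow, Polynomial.smul_eq_C_mul]
      simp
    rw [PowerSeries.coeff_succ_X_mul, PowerSeries.coeff_mk, negGeom, PowerSeries.coeff_mk,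
      h1, map_smul, residue_X_pow, map_sub, PowerSeries.coeff_one, if_neg n.succ_ne_zero, zero_sub,
      PowerSeries.evalNegHom, PowerSeries.coeff_rescale, pow_succ, smul_eq_mul]
    ring

theorem residueSeries_one : residueSeries 1 = seriesR dxOp - seriesL dxOp := by
  have h1 : residue 1 = opR (MvPolynomial.X 0) - opL (MvPolynomial.X 0) := by
    rw [← pow_zero X, residue_X_pow, zero_add]
    have h := congrArg PowerSeries.constantCoeff derivative_pairVertex
    rw [← PowerSeries.coeff_zero_eq_constantCoeff_apply, PowerSeries.coeff_derivative, map_mul,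
      constantCoeff_pairVertex, map_sub, map_weight, map_weight] at h
    simpa [weight, ← PowerSeries.coeff_zero_eq_constantCoeff_apply] using h
  rw [seriesR, seriesL, dxOp, MvPowerSeries.map_C, MvPowerSeries.map_C, ← map_sub]
  refine Eq.trans ?_ (congrArg MvPowerSeries.C h1)
  classical
  ext1 e
  rw [residueSeries, coeff_coeffwise, MvPowerSeries.coeff_one, MvPowerSeries.coeff_C]
  split_ifs with h
  · rfl
  · exact map_zero residue

end Identities

/-! ### Four bilinear identities -/

section Bilinear

open Polynomial

theorem residueSeries_X_mul (i : Fin 2) (K : MvPowerSeries (Fin 2) BiOp[X]) :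
    residueSeries (MvPowerSeries.X i * K) = MvPowerSeries.X i * residueSeries K := by
  rw [← residueSeries_map_C_mul, MvPowerSeries.map_X]

theorem seriesL_shiftOp_mul_unshiftOp (i : Fin 2) :
    seriesL (shiftOp i) * seriesL (unshiftOp i) = 1 := by
  rw [← map_mul seriesL, shiftOp_mul_unshiftOp, map_one]

theorem seriesR_shiftOp_mul_unshiftOp (i : Fin 2) :
    seriesR (shiftOp i) * seriesR (unshiftOp i) = 1 := by
  rw [← map_mul seriesR, shiftOp_mul_unshiftOp, map_one]

/-- The residue of `1 / ((1 - z ξ₀) (1 - z ξ₁))`, by partial fractions. -/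
theorem residueSeries_geom_mul_geom :
    (MvPowerSeries.X 0 - MvPowerSeries.X 1) *
        residueSeries (atVar 0 geom * atVar 1 geom) =
      seriesL (shiftOp 0) * seriesR (unshiftOp 0) -
        seriesL (shiftOp 1) * seriesR (unshiftOp 1) := by
  have h0 := one_sub_mul_atVar_geom 0
  have h1 := one_sub_mul_atVar_geom 1
  have hG : (MvPowerSeries.X 0 - MvPowerSeries.X 1) * (atVar 0 geom * atVar 1 geom) =
      MvPowerSeries.X 0 * atVar 0 geom - MvPowerSeries.X 1 * atVar 1 geom := by
    linear_combination MvPowerSeries.X 0 * atVar 0 geom * h1 - MvPowerSeries.X 1 * atVar 1 geom * h0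
  have h := congrArg residueSeries hG
  rw [sub_mul, map_sub, map_sub, residueSeries_X_mul, residueSeries_X_mul, residueSeries_X_mul,
    residueSeries_X_mul] at h
  linear_combination h + X_mul_residueSeries_geom 0 - X_mul_residueSeries_geom 1

/-- The residue of `z / ((1 - z ξ₀) (1 - z ξ₁))`, by partial fractions. -/
theorem residueSeries_X_mul_geom_mul_geom :
    MvPowerSeries.X 0 * MvPowerSeries.X 1 * ((MvPowerSeries.X 0 - MvPowerSeries.X 1) *
        residueSeries (MvPowerSeries.C X * (atVar 0 geom * atVar 1 geom))) =
      MvPowerSeries.X 1 * (seriesL (shiftOp 0) * seriesR (unshiftOp 0) - 1) -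
        MvPowerSeries.X 0 * (seriesL (shiftOp 1) * seriesR (unshiftOp 1) - 1) := by
  have h0 := one_sub_mul_atVar_geom 0
  have h1 := one_sub_mul_atVar_geom 1
  have hG : (MvPowerSeries.X 0 - MvPowerSeries.X 1) *
      (MvPowerSeries.C X * (atVar 0 geom * atVar 1 geom)) =
      atVar 0 geom - atVar 1 geom := by
    linear_combination atVar 0 geom * h1 - atVar 1 geom * h0
  have h := congrArg residueSeries hG
  rw [sub_mul, map_sub, map_sub, residueSeries_X_mul, residueSeries_X_mul] at h
  linear_combination MvPowerSeries.X 0 * MvPowerSeries.X 1 * h +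
    MvPowerSeries.X 1 * X_mul_residueSeries_geom 0 - MvPowerSeries.X 0 * X_mul_residueSeries_geom 1

theorem hirotaSeries_X_mul (τ : Fock) (i : Fin 2) (K : MvPowerSeries (Fin 2) BiOp) :
    hirotaSeries τ (MvPowerSeries.X i * K) = MvPowerSeries.X i * hirotaSeries τ K := by
  have h := hirotaSeries_map_mul τ (MvPowerSeries.X i) K
  rwa [MvPowerSeries.map_X, MvPowerSeries.map_X] at h

/-- The Wronskian of `ψ(z)` and `ψ(w)`, with denominators cleared: the bilinear identity for the
operator `∂/∂x̃` composed with the shift of `t̃` by `-[z⁻¹] - [w⁻¹]`. -/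
theorem shift_wronskian {τ : Fock} (hτ : IsTauFunction τ) :
    MvPowerSeries.X 0 * (MvPowerSeries.X 1 *
        (evalSeries₂ τ (shiftOp 0) * evalSeries₂ τ (dxOp * shiftOp 1) -
          evalSeries₂ τ (dxOp * shiftOp 0) * evalSeries₂ τ (shiftOp 1))) =
      (MvPowerSeries.X 1 - MvPowerSeries.X 0) *
        (evalSeries₂ τ (shiftOp 0) * evalSeries₂ τ (shiftOp 1) -
          evalSeries₂ τ 1 * evalSeries₂ τ (shiftOp 0 * shiftOp 1)) := by
  have hW : MvPowerSeries.map conj.toRingHom (seriesR (shiftOp 0) * seriesR (shiftOp 1)) =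
      MvPowerSeries.map Polynomial.C (seriesR (shiftOp 0) * seriesR (shiftOp 1)) *
        (atVar 0 phaseKernel * atVar 1 phaseKernel) := by
    rw [map_mul, map_mul, map_conj_seriesR_shiftOp, map_conj_seriesR_shiftOp]
    ring
  have h := hirotaSeries_kernel hτ hW (seriesR dxOp) 1
  rw [map_conj_seriesR_dxOp, map_one, mul_one, sub_mul, map_sub, residueSeries_map_C_mul] at h
  have hK : MvPowerSeries.X 0 * (MvPowerSeries.X 1 * ((MvPowerSeries.X 0 - MvPowerSeries.X 1) *
      (seriesR (shiftOp 0) * seriesR (shiftOp 1) *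
        (seriesR dxOp * residueSeries (atVar 0 geom * atVar 1 geom) -
          residueSeries (MvPowerSeries.C X * (atVar 0 geom * atVar 1 geom)))))) =
      MvPowerSeries.X 0 * (MvPowerSeries.X 1 * (seriesL (shiftOp 0) * seriesR (dxOp * shiftOp 1))) -
        MvPowerSeries.X 0 *
          (MvPowerSeries.X 1 * (seriesL (shiftOp 1) * seriesR (dxOp * shiftOp 0))) -
        MvPowerSeries.X 1 * (seriesL (shiftOp 0) * seriesR (shiftOp 1)) +
        MvPowerSeries.X 1 * (seriesL 1 * seriesR (shiftOp 0 * shiftOp 1)) +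
        MvPowerSeries.X 0 * (seriesL (shiftOp 1) * seriesR (shiftOp 0)) -
        MvPowerSeries.X 0 * (seriesL 1 * seriesR (shiftOp 0 * shiftOp 1)) := by
    have h0 := seriesR_shiftOp_mul_unshiftOp 0
    have h1 := seriesR_shiftOp_mul_unshiftOp 1
    have r0 := residueSeries_geom_mul_geom
    have r1 := residueSeries_X_mul_geom_mul_geom
    simp only [map_mul seriesR, map_one]
    generalize residueSeries (atVar 0 geom * atVar 1 geom) = A at *
    generalize residueSeries (MvPowerSeries.C X * (atVar 0 geom * atVar 1 geom)) = B at *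
    generalize seriesR (shiftOp 0) = r at *
    generalize seriesR (shiftOp 1) = s at *
    generalize seriesR (unshiftOp 0) = r' at *
    generalize seriesR (unshiftOp 1) = s' at *
    generalize seriesL (shiftOp 0) = l at *
    generalize seriesL (shiftOp 1) = m at *
    generalize seriesR dxOp = d at *
    generalize (MvPowerSeries.X 0 : MvPowerSeries (Fin 2) BiOp) = a at *
    generalize (MvPowerSeries.X 1 : MvPowerSeries (Fin 2) BiOp) = b at *
    linear_combination a * b * r * s * d * r0 - r * s * r1 + (a * b * d - b) * l * s * h0 -
      (a * b * d - a) * m * r * h1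
  have h' := congrArg (hirotaSeries τ) hK
  rw [hirotaSeries_X_mul, hirotaSeries_X_mul, sub_mul, map_sub, hirotaSeries_X_mul,
    hirotaSeries_X_mul, h] at h'
  simp only [map_add, map_sub, hirotaSeries_X_mul, hirotaSeries_seriesL_mul_seriesR] at h'
  linear_combination -h'

/-- The Wronskian of `ψ(-z)` and `ψ(-w)`, with denominators cleared: the bilinear identity for the
operator `∂/∂x` composed with the shift of `t` by `[z⁻¹] + [w⁻¹]`. -/
theorem unshift_wronskian {τ : Fock} (hτ : IsTauFunction τ) :
    MvPowerSeries.X 0 * (MvPowerSeries.X 1 *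
        (evalSeries₂ τ (unshiftOp 0) * evalSeries₂ τ (dxOp * unshiftOp 1) -
          evalSeries₂ τ (dxOp * unshiftOp 0) * evalSeries₂ τ (unshiftOp 1))) =
      (MvPowerSeries.X 0 - MvPowerSeries.X 1) *
        (evalSeries₂ τ (unshiftOp 0) * evalSeries₂ τ (unshiftOp 1) -
          evalSeries₂ τ 1 * evalSeries₂ τ (unshiftOp 0 * unshiftOp 1)) := by
  have hW : MvPowerSeries.map conj.toRingHom (seriesL (unshiftOp 0) * seriesL (unshiftOp 1)) =
      MvPowerSeries.map Polynomial.C (seriesL (unshiftOp 0) * seriesL (unshiftOp 1)) *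
        (atVar 0 phaseKernel * atVar 1 phaseKernel) := by
    rw [map_mul, map_mul, map_conj_seriesL_unshiftOp, map_conj_seriesL_unshiftOp]
    ring
  have h := hirotaSeries_kernel hτ hW (seriesL dxOp) 1
  rw [map_conj_seriesL_dxOp, map_one, mul_one, add_mul, map_add, residueSeries_map_C_mul] at h
  have hK : MvPowerSeries.X 0 * (MvPowerSeries.X 1 * ((MvPowerSeries.X 0 - MvPowerSeries.X 1) *
      (seriesL (unshiftOp 0) * seriesL (unshiftOp 1) *
        (seriesL dxOp * residueSeries (atVar 0 geom * atVar 1 geom) +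
          residueSeries (MvPowerSeries.C X * (atVar 0 geom * atVar 1 geom)))))) =
      MvPowerSeries.X 0 *
          (MvPowerSeries.X 1 * (seriesL (dxOp * unshiftOp 1) * seriesR (unshiftOp 0))) -
        MvPowerSeries.X 0 *
          (MvPowerSeries.X 1 * (seriesL (dxOp * unshiftOp 0) * seriesR (unshiftOp 1))) +
        MvPowerSeries.X 1 * (seriesL (unshiftOp 1) * seriesR (unshiftOp 0)) -
        MvPowerSeries.X 1 * (seriesL (unshiftOp 0 * unshiftOp 1) * seriesR 1) -
        MvPowerSeries.X 0 * (seriesL (unshiftOp 0) * seriesR (unshiftOp 1)) +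
        MvPowerSeries.X 0 * (seriesL (unshiftOp 0 * unshiftOp 1) * seriesR 1) := by
    have h0 := seriesL_shiftOp_mul_unshiftOp 0
    have h1 := seriesL_shiftOp_mul_unshiftOp 1
    have r0 := residueSeries_geom_mul_geom
    have r1 := residueSeries_X_mul_geom_mul_geom
    simp only [map_mul seriesL, map_one]
    generalize residueSeries (atVar 0 geom * atVar 1 geom) = A at *
    generalize residueSeries (MvPowerSeries.C X * (atVar 0 geom * atVar 1 geom)) = B at *
    generalize seriesL (shiftOp 0) = r at *
    generalize seriesL (shiftOp 1) = s at *
    generalize seriesL (unshiftOp 0) = r' at *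
    generalize seriesL (unshiftOp 1) = s' at *
    generalize seriesR (unshiftOp 0) = l at *
    generalize seriesR (unshiftOp 1) = m at *
    generalize seriesL dxOp = d at *
    generalize (MvPowerSeries.X 0 : MvPowerSeries (Fin 2) BiOp) = a at *
    generalize (MvPowerSeries.X 1 : MvPowerSeries (Fin 2) BiOp) = b at *
    linear_combination a * b * r' * s' * d * r0 + r' * s' * r1 + (a * b * d + b) * l * s' * h0 -
      (a * b * d + a) * m * r' * h1
  have h' := congrArg (hirotaSeries τ) hK
  rw [hirotaSeries_X_mul, hirotaSeries_X_mul, sub_mul, map_sub, hirotaSeries_X_mul,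
    hirotaSeries_X_mul, h] at h'
  simp only [map_add, map_sub, hirotaSeries_X_mul, hirotaSeries_seriesL_mul_seriesR] at h'
  linear_combination -h'

theorem map_conj_pair (i : Fin 2) :
    MvPowerSeries.map conj.toRingHom (seriesR (shiftOp i) * seriesL (unshiftOp i)) =
      MvPowerSeries.map Polynomial.C (seriesR (shiftOp i) * seriesL (unshiftOp i)) *
        (atVar i phaseKernel * atVar i phaseKernel) := by
  rw [map_mul, map_mul, map_conj_seriesR_shiftOp, map_conj_seriesL_unshiftOp]
  ring

/-- The Wronskian of `ψ(z)` and `ψ(-z)`, with denominators cleared: the bilinear identity for the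
shift of `t` by `[z⁻¹]` and of `t̃` by `-[z⁻¹]`. -/
theorem shift_unshift_wronskian {τ : Fock} (hτ : IsTauFunction τ) (i : Fin 2) :
    MvPowerSeries.X i * (evalSeries₂ τ (shiftOp i) * evalSeries₂ τ (dxOp * unshiftOp i) -
        evalSeries₂ τ (dxOp * shiftOp i) * evalSeries₂ τ (unshiftOp i)) =
      2 * (evalSeries₂ τ (shiftOp i) * evalSeries₂ τ (unshiftOp i) -
        evalSeries₂ τ 1 * evalSeries₂ τ 1) := by
  have h := hirotaSeries_kernel hτ (map_conj_pair i) 1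
    (1 - MvPowerSeries.C X * MvPowerSeries.X i ^ 2)
  -- `(1 - z² ξ²) / (1 - z ξ)² = 2 / (1 - z ξ) - 1`
  have hE : MvPowerSeries.map conj.toRingHom 1 * MvPowerSeries.map evenPoly
      (1 - MvPowerSeries.C X * MvPowerSeries.X i ^ 2) * (atVar i geom * atVar i geom) =
      atVar i geom + atVar i geom - 1 := by
    have h0 := one_sub_mul_atVar_geom i
    rw [map_one, map_sub, map_mul, map_pow, map_one, MvPowerSeries.map_X, MvPowerSeries.map_C,
      evenPoly_X, map_pow]
    linear_combination ((1 + MvPowerSeries.C X * MvPowerSeries.X i) * atVar i geom - 1) * h0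
  rw [hE, map_sub, map_add, residueSeries_one] at h
  have hK : MvPowerSeries.X i * (seriesR (shiftOp i) * seriesL (unshiftOp i) *
      (residueSeries (atVar i geom) + residueSeries (atVar i geom) -
        (seriesR dxOp - seriesL dxOp))) =
      seriesL 1 * seriesR 1 + seriesL 1 * seriesR 1 -
        seriesL (unshiftOp i) * seriesR (shiftOp i) -
        seriesL (unshiftOp i) * seriesR (shiftOp i) -
        MvPowerSeries.X i * (seriesL (unshiftOp i) * seriesR (dxOp * shiftOp i)) +
        MvPowerSeries.X i * (seriesL (dxOp * unshiftOp i) * seriesR (shiftOp i)) := by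
    have h0 := seriesL_shiftOp_mul_unshiftOp i
    have h1 := seriesR_shiftOp_mul_unshiftOp i
    have r0 := X_mul_residueSeries_geom i
    simp only [map_mul seriesL, map_mul seriesR, map_one]
    linear_combination 2 * seriesR (shiftOp i) * seriesL (unshiftOp i) * r0 +
      2 * seriesR (shiftOp i) * seriesR (unshiftOp i) * h0 + 2 * h1
  have h' := congrArg (hirotaSeries τ) hK
  rw [hirotaSeries_X_mul, h] at h'
  simp only [map_add, map_sub, hirotaSeries_X_mul, hirotaSeries_seriesL_mul_seriesR] at h'
  linear_combination -h'

/-- The even part `∑ y^j ξ^(2j)` of the expansion of `1 / (1 - z ξ)`, where `y = z^2`. -/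
def evenGeom : PowerSeries ℂ[X] := PowerSeries.mk fun n => if Even n then X ^ (n / 2) else 0

theorem X_mul_weight_phaseCoeff : PowerSeries.X * weight phaseCoeff -
    PowerSeries.map evenPoly evenGeom = -negGeom := by
  ext1 n
  rw [map_sub, map_neg, PowerSeries.coeff_map, evenGeom, negGeom, PowerSeries.coeff_mk,
    PowerSeries.coeff_mk, weight_phaseCoeff]
  cases n with
  | zero => simp
  | succ n =>
    rw [PowerSeries.coeff_succ_X_mul, PowerSeries.coeff_mk]
    rcases Nat.even_or_odd n with h | h
    · rw [if_pos h, if_neg (Nat.not_even_iff_odd.2 h.add_one), map_zero, sub_zero,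
        h.add_one.neg_pow, neg_neg]
    · have h2 : 2 * ((n + 1) / 2) = n + 1 :=
        Nat.mul_div_cancel' (even_iff_two_dvd.1 h.add_one)
      rw [if_neg (Nat.not_even_iff_odd.2 h), if_pos h.add_one, map_pow, evenPoly_X, ← pow_mul, h2,
        zero_sub, h.add_one.neg_pow]

theorem map_conj_seriesL_insertOp (i : Fin 2) :
    MvPowerSeries.map conj.toRingHom (seriesL (insertOp i)) =
      MvPowerSeries.map Polynomial.C (seriesL (insertOp i)) +
        MvPowerSeries.X i ^ 2 * atVar i (weight phaseCoeff) := by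
  have h1 : PowerSeries.map conj.toRingHom (PowerSeries.map opL.toRingHom
      (weight MvPolynomial.X)) = PowerSeries.map Polynomial.C (PowerSeries.map opL.toRingHom
      (weight MvPolynomial.X)) + weight phaseCoeff := by
    rw [map_weight, map_weight, map_weight, ← weight_add]
    congr 1
    ext1 k
    exact conj_opL_X k
  rw [seriesL, insertOp, map_atVar, map_atVar, map_atVar, map_mul, map_pow, PowerSeries.map_X,
    map_mul, map_pow, PowerSeries.map_X, map_mul (PowerSeries.map Polynomial.C), map_pow,
    PowerSeries.map_X, h1, ← atVar_X, ← map_pow (atVar i), ← map_mul (atVar i),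
    ← map_add (atVar i), mul_add]

/-- The two-point function in terms of the shifted tau-functions: the bilinear identity for the
shift of `t` by `[z⁻¹]` and of `t̃` by `-[z⁻¹]`, composed with the insertion operator at `w`. -/
theorem insert_insert {τ : Fock} (hτ : IsTauFunction τ) :
    (MvPowerSeries.X 0 + MvPowerSeries.X 1) ^ 2 *
        (evalSeries₂ τ (insertOp 1 * insertOp 0) * evalSeries₂ τ 1 -
          evalSeries₂ τ (insertOp 1) * evalSeries₂ τ (insertOp 0)) =
      MvPowerSeries.X 0 ^ 2 * MvPowerSeries.X 1 ^ 2 *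
        (evalSeries₂ τ (unshiftOp 0 * unshiftOp 1) * evalSeries₂ τ (shiftOp 0 * shiftOp 1) -
          evalSeries₂ τ 1 * evalSeries₂ τ 1) := by
  have hA := hirotaSeries_kernel hτ (map_conj_pair 0) (seriesL (insertOp 1)) 1
  have hB := hirotaSeries_kernel hτ (map_conj_pair 0) 1
    (MvPowerSeries.X 1 * atVar 1 evenGeom)
  -- Subtracting the even part `evenGeom` from the phase of the insertion operator leaves the
  -- rational kernel `negGeom`.
  have h := congrArg₂ (· - ·) hA hB
  simp only [sub_zero] at h
  have hN := congrArg (atVar 1) X_mul_weight_phaseCoeff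
  rw [map_sub (atVar 1), map_mul (atVar 1), atVar_X, map_neg (atVar 1)] at hN
  have hT : MvPowerSeries.map conj.toRingHom (seriesL (insertOp 1)) *
      MvPowerSeries.map evenPoly 1 * (atVar 0 geom * atVar 0 geom) -
      MvPowerSeries.map conj.toRingHom 1 *
        MvPowerSeries.map evenPoly (MvPowerSeries.X 1 * atVar 1 evenGeom) *
        (atVar 0 geom * atVar 0 geom) =
      MvPowerSeries.map Polynomial.C (seriesL (insertOp 1)) * (atVar 0 geom * atVar 0 geom) -
        MvPowerSeries.X 1 * (atVar 1 negGeom * (atVar 0 geom * atVar 0 geom)) := by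
    rw [map_one, map_one, map_mul, MvPowerSeries.map_X, map_atVar, map_conj_seriesL_insertOp]
    linear_combination (MvPowerSeries.X 1 * (atVar 0 geom * atVar 0 geom)) * hN
  rw [← map_sub (hirotaSeries τ), ← mul_sub, ← map_sub residueSeries, hT,
    map_sub residueSeries, residueSeries_map_C_mul, residueSeries_X_mul] at h
  have hH : MvPowerSeries.X 0 * (MvPowerSeries.X 0 * (atVar 1 negGeom *
        (atVar 0 geom * atVar 0 geom))) +
      MvPowerSeries.X 0 * (MvPowerSeries.X 1 * (atVar 1 negGeom *
        (atVar 0 geom * atVar 0 geom))) +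
      (MvPowerSeries.X 1 * (MvPowerSeries.X 0 * (atVar 1 negGeom *
        (atVar 0 geom * atVar 0 geom))) +
      MvPowerSeries.X 1 * (MvPowerSeries.X 1 * (atVar 1 negGeom *
        (atVar 0 geom * atVar 0 geom)))) =
      MvPowerSeries.X 1 * (MvPowerSeries.X 1 * atVar 1 negGeom) +
        MvPowerSeries.X 0 * (MvPowerSeries.X 1 * atVar 0 geom) +
        (MvPowerSeries.X 0 * (MvPowerSeries.X 0 * (atVar 0 geom * atVar 0 geom)) +
        MvPowerSeries.X 0 * (MvPowerSeries.X 1 * (atVar 0 geom * atVar 0 geom))) := by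
    have g0 := one_sub_mul_atVar_geom 0
    have g1 := one_add_mul_atVar_negGeom 1
    generalize atVar 0 geom = G at *
    generalize atVar 1 negGeom = H at *
    generalize (MvPowerSeries.C X : MvPowerSeries (Fin 2) BiOp[X]) = z at *
    generalize (MvPowerSeries.X 0 : MvPowerSeries (Fin 2) BiOp[X]) = a at *
    generalize (MvPowerSeries.X 1 : MvPowerSeries (Fin 2) BiOp[X]) = b at *
    -- `(a + b)^2 = b^2 (1 - z a)^2 + a b (1 - z a) (1 + z b) + a (a + b) (1 + z b)`
    linear_combination (b ^ 2 * H * ((1 - z * a) * G + 1) + a * b * (1 + z * b) * H * G) * g0 +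
      (a * b * G + a * (a + b) * G ^ 2) * g1
  have hR := congrArg residueSeries hH
  simp only [map_add, residueSeries_X_mul] at hR
  have hK : MvPowerSeries.X 0 * (MvPowerSeries.X 0 *
      ((MvPowerSeries.X 0 + MvPowerSeries.X 1) * ((MvPowerSeries.X 0 + MvPowerSeries.X 1) *
      (seriesR (shiftOp 0) * seriesL (unshiftOp 0) *
        (seriesL (insertOp 1) * residueSeries (atVar 0 geom * atVar 0 geom) -
          MvPowerSeries.X 1 *
            residueSeries (atVar 1 negGeom * (atVar 0 geom * atVar 0 geom))))))) =
      (MvPowerSeries.X 0 + MvPowerSeries.X 1) * ((MvPowerSeries.X 0 + MvPowerSeries.X 1) *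
          (seriesL (insertOp 1) * seriesR (insertOp 0) -
            seriesL (insertOp 1 * insertOp 0) * seriesR 1)) -
        MvPowerSeries.X 0 * (MvPowerSeries.X 0 * (MvPowerSeries.X 1 * (MvPowerSeries.X 1 *
          (seriesL 1 * seriesR 1 -
            seriesL (unshiftOp 0 * unshiftOp 1) * seriesR (shiftOp 0 * shiftOp 1))))) -
        MvPowerSeries.X 0 * (MvPowerSeries.X 1 * ((MvPowerSeries.X 0 + MvPowerSeries.X 1) *
          (seriesL 1 * seriesR (insertOp 0) - seriesL (insertOp 0) * seriesR 1))) := by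
    have h0 := seriesL_shiftOp_mul_unshiftOp 0
    have h1 := seriesR_shiftOp_mul_unshiftOp 0
    have r0 := X_mul_residueSeries_geom 0
    have r1 := X_mul_residueSeries_negGeom 1
    have r2 := X_sq_mul_residueSeries_geom_sq 0
    simp only [map_mul seriesL, map_mul seriesR, map_one]
    generalize residueSeries (atVar 0 geom * atVar 0 geom) = A at *
    generalize residueSeries (atVar 1 negGeom * (atVar 0 geom * atVar 0 geom)) = B at *
    generalize residueSeries (atVar 0 geom) = G at *
    generalize residueSeries (atVar 1 negGeom) = H at *
    generalize seriesR (shiftOp 0) = r at *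
    generalize seriesR (shiftOp 1) = s at *
    generalize seriesR (unshiftOp 0) = r' at *
    generalize seriesL (unshiftOp 0) = l at *
    generalize seriesL (unshiftOp 1) = m at *
    generalize seriesL (shiftOp 0) = l' at *
    generalize seriesL (insertOp 0) = D at *
    generalize seriesL (insertOp 1) = E at *
    generalize seriesR (insertOp 0) = F at *
    generalize (MvPowerSeries.X 0 : MvPowerSeries (Fin 2) BiOp) = a at *
    generalize (MvPowerSeries.X 1 : MvPowerSeries (Fin 2) BiOp) = b at *
    have hu : r * l * (l' * r') = 1 := by linear_combination h1 + r * r' * h0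
    linear_combination r * l * ((a + b) ^ 2 * E - a * b * (a + b)) * r2 -
      a ^ 2 * b * r * l * hR - a ^ 2 * b ^ 2 * r * l * (r0 + r1) +
      (((a + b) ^ 2 * E - a * b * (a + b)) * (F - D) - a ^ 2 * b ^ 2) * hu
  have h' := congrArg (hirotaSeries τ) hK
  simp only [add_mul, map_add, map_sub, hirotaSeries_X_mul, h,
    hirotaSeries_seriesL_mul_seriesR] at h'
  linear_combination h'

end Bilinear

/-! ### Functions of the times and of two spectral parameters -/

section Transfer

/-- The embedding `ℂ[[t]][[z⁻¹, w⁻¹]] → Funs`. -/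
def toFuns : MvPowerSeries (Fin 2) Fock →+* Funs :=
  (MvPowerSeries.map (algebraMap (MvPowerSeries (Fin 2) ℂ) Coef)).comp (swap ℕ (Fin 2) ℂ)

/-- The spectral parameters `z` and `w` as a family. -/
def specPar (i : Fin 2) : PowerSeries ℂ →+* Coef :=
  (algebraMap (MvPowerSeries (Fin 2) ℂ) Coef).comp (atVar i)

theorem zPar_eq : zPar = specPar 0 := rfl

theorem wPar_eq : wPar = specPar 1 := rfl

theorem toFuns_injective : Function.Injective toFuns := by
  refine Function.Injective.comp
    (g := MvPowerSeries.map (algebraMap (MvPowerSeries (Fin 2) ℂ) Coef))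
    (fun F G h => ?_) (swap_injective (σ := ℕ) (τ := Fin 2))
  ext1 a
  apply IsFractionRing.injective (MvPowerSeries (Fin 2) ℂ) Coef
  rw [← MvPowerSeries.coeff_map, h, MvPowerSeries.coeff_map]

theorem swap_atVar (i : Fin 2) (F : PowerSeries Fock) :
    swap ℕ (Fin 2) ℂ (atVar i F) = MvPowerSeries.map (atVar i) (swap ℕ Unit ℂ F) := by
  ext1 a
  ext1 e
  rw [coeff_coeff_swap, MvPowerSeries.coeff_map, coeff_atVar, coeff_atVar]
  split_ifs
  · rfl
  · rw [map_zero]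

theorem evalSeries₂_atVar (τ : Fock) (i : Fin 2) (F : PowerSeries DiffOp) :
    evalSeries₂ τ (atVar i F) = atVar i (evalSeries τ F) :=
  coeffwise_atVar i _ F

theorem toFuns_atVar (i : Fin 2) (F : PowerSeries Fock) :
    toFuns (atVar i F) = MvPowerSeries.map (specPar i) (swap ℕ Unit ℂ F) := by
  rw [toFuns, RingHom.comp_apply, swap_atVar, specPar]
  rfl

theorem toFuns_shiftOp (τ : Fock) (i : Fin 2) :
    toFuns (evalSeries₂ τ (shiftOp i)) = shifted τ (specPar i) := by
  rw [shiftOp, evalSeries₂_atVar, toFuns_atVar, shifted_eq]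

theorem toFuns_unshiftOp (τ : Fock) (i : Fin 2) :
    toFuns (evalSeries₂ τ (unshiftOp i)) = shifted τ (neg (specPar i)) := by
  rw [unshiftOp, evalSeries₂_atVar, toFuns_atVar, shifted_neg_eq]

theorem toFuns_dxOp_mul_atVar (τ : Fock) (i : Fin 2) (F : PowerSeries DiffOp) :
    toFuns (evalSeries₂ τ (dxOp * atVar i F)) =
      MvPowerSeries.pderiv Coef 0 (toFuns (evalSeries₂ τ (atVar i F))) := by
  rw [dxOp, ← atVar_C i, ← map_mul (atVar i), evalSeries₂_atVar, evalSeries₂_atVar, toFuns_atVar,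
    toFuns_atVar, pderiv_map, pderiv_swap_evalSeries]

theorem toFuns_dxOp_mul_shiftOp (τ : Fock) (i : Fin 2) :
    toFuns (evalSeries₂ τ (dxOp * shiftOp i)) =
      MvPowerSeries.pderiv Coef 0 (shifted τ (specPar i)) := by
  rw [← toFuns_shiftOp, shiftOp, toFuns_dxOp_mul_atVar]

theorem toFuns_dxOp_mul_unshiftOp (τ : Fock) (i : Fin 2) :
    toFuns (evalSeries₂ τ (dxOp * unshiftOp i)) =
      MvPowerSeries.pderiv Coef 0 (shifted τ (neg (specPar i))) := by
  rw [← toFuns_unshiftOp, unshiftOp, toFuns_dxOp_mul_atVar]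

theorem evalSeries₂_one (τ : Fock) : evalSeries₂ τ 1 = MvPowerSeries.C τ := by
  classical
  ext1 e
  rw [evalSeries₂, coeff_coeffwise, MvPowerSeries.coeff_one, MvPowerSeries.coeff_C]
  split_ifs
  · refine (evalAt_apply τ 1).trans ?_
    rw [map_one]
    rfl
  · exact map_zero (evalAt τ)

theorem toFuns_one (τ : Fock) :
    toFuns (evalSeries₂ τ 1) = MvPowerSeries.map (algebraMap ℂ Coef) τ := by
  rw [evalSeries₂_one, toFuns, RingHom.comp_apply, swap_C,
    IsScalarTower.algebraMap_eq ℂ (MvPowerSeries (Fin 2) ℂ) Coef]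
  rfl

theorem param_specPar (i : Fin 2) :
    param (specPar i) = (algebraMap (MvPowerSeries (Fin 2) ℂ) Coef (MvPowerSeries.X i))⁻¹ := by
  rw [param, specPar, RingHom.comp_apply, atVar_X]

theorem X_ne_zero (i : Fin 2) : (MvPowerSeries.X i : MvPowerSeries (Fin 2) ℂ) ≠ 0 := by
  intro h
  have h1 := congrArg (MvPowerSeries.coeff (Finsupp.single i 1)) h
  rw [MvPowerSeries.coeff_index_single_self_X, map_zero] at h1
  exact one_ne_zero h1

theorem toFuns_X (i : Fin 2) :
    toFuns (MvPowerSeries.X i) * MvPowerSeries.C (param (specPar i)) = 1 := by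
  have h : (MvPowerSeries.X i : MvPowerSeries (Fin 2) Fock) =
      MvPowerSeries.map MvPowerSeries.C (MvPowerSeries.X i) := (MvPowerSeries.map_X _ i).symm
  rw [h, toFuns, RingHom.comp_apply, swap_map_C, MvPowerSeries.map_C, ← map_mul, param_specPar,
    mul_inv_cancel₀, map_one]
  rw [Ne, IsFractionRing.to_map_eq_zero_iff]
  exact X_ne_zero i

theorem coeff_X_sq_mul_weight (n : ℕ) :
    PowerSeries.coeff n (PowerSeries.X ^ 2 * weight (MvPolynomial.X : ℕ → DiffOp)) =
      ∑ k ∈ Finset.range n,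
        if n = 2 * k + 2 then ((2 * k + 1)‼ : DiffOp) * MvPolynomial.X k else 0 := by
  rw [PowerSeries.coeff_X_pow_mul']
  split_ifs with h
  · obtain ⟨m, rfl⟩ := Nat.exists_eq_add_of_le' h
    rw [Nat.add_sub_cancel, weight, PowerSeries.coeff_mk]
    split_ifs with hm
    · obtain ⟨k, rfl⟩ := even_iff_two_dvd.1 hm
      rw [Finset.sum_eq_single k, if_pos rfl, Nat.mul_div_cancel_left k two_pos]
      · intro l _ hl
        rw [if_neg]
        omega
      · intro hk
        rw [Finset.mem_range] at hk
        omega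
    · symm
      refine Finset.sum_eq_zero fun k _ => if_neg fun hk => hm ?_
      exact even_iff_two_dvd.2 ⟨k, by omega⟩
  · symm
    refine Finset.sum_eq_zero fun k _ => if_neg ?_
    omega

theorem coeff_coeff_insertOp (τ : Fock) (a : ℕ →₀ ℕ) (e : Fin 2 →₀ ℕ) :
    MvPowerSeries.coeff a (MvPowerSeries.coeff e
      (evalSeries₂ τ (insertOp 1 * insertOp 0) * evalSeries₂ τ 1 -
        evalSeries₂ τ (insertOp 1) * evalSeries₂ τ (insertOp 0))) =
      ∑ k ∈ Finset.range (e 0), ∑ l ∈ Finset.range (e 1),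
        if e 0 = 2 * k + 2 ∧ e 1 = 2 * l + 2 then
          MvPowerSeries.coeff a (corrNum τ k l) * ((2 * k + 1)‼ : ℕ) * ((2 * l + 1)‼ : ℕ)
        else 0 := by
  have hop : MvPowerSeries.coeff e (evalSeries₂ τ (insertOp 0 * insertOp 1)) =
      evalAt τ (MvPowerSeries.coeff e (insertOp 0 * insertOp 1)) := rfl
  rw [evalSeries₂_one, mul_comm (insertOp 1), mul_comm (evalSeries₂ τ (insertOp 1)),
    map_sub, mul_comm _ (MvPowerSeries.C τ), MvPowerSeries.coeff_C_mul, hop, insertOp, insertOp,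
    evalSeries₂_atVar, evalSeries₂_atVar, coeff_atVar_mul_atVar, coeff_atVar_mul_atVar,
    coeff_evalSeries, coeff_evalSeries, coeff_X_sq_mul_weight, coeff_X_sq_mul_weight]
  have hev : ∀ k, evalAt τ (((2 * k + 1)‼ : DiffOp) * MvPolynomial.X k) =
      MvPowerSeries.C ((2 * k + 1)‼ : ℂ) * MvPowerSeries.pderiv ℂ k τ := by
    intro k
    rw [evalAt_apply, ← nsmul_eq_mul, map_nsmul, LinearMap.smul_apply, act_X]
    simp
  have hev₂ : ∀ k l, evalAt τ (((2 * k + 1)‼ : DiffOp) * MvPolynomial.X k *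
      (((2 * l + 1)‼ : DiffOp) * MvPolynomial.X l)) =
      MvPowerSeries.C ((2 * k + 1)‼ : ℂ) * MvPowerSeries.C ((2 * l + 1)‼ : ℂ) *
        MvPowerSeries.pderiv ℂ k (MvPowerSeries.pderiv ℂ l τ) := by
    intro k l
    rw [mul_mul_mul_comm, evalAt_apply, ← Nat.cast_mul, ← nsmul_eq_mul, map_nsmul,
      LinearMap.smul_apply, act_X_mul, act_X]
    simp
  rw [Finset.sum_mul_sum]
  simp only [map_sum]
  rw [Finset.sum_mul_sum, Finset.mul_sum, ← Finset.sum_sub_distrib, map_sum]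
  refine Finset.sum_congr rfl fun k _ => ?_
  rw [Finset.mul_sum, ← Finset.sum_sub_distrib, map_sum]
  refine Finset.sum_congr rfl fun l _ => ?_
  by_cases h0 : e 0 = 2 * k + 2
  · by_cases h1 : e 1 = 2 * l + 2
    · rw [if_pos h0, if_pos h1, if_pos ⟨h0, h1⟩, hev₂, hev, hev, corrNum]
      have hC : τ * (MvPowerSeries.C ((2 * k + 1)‼ : ℂ) * MvPowerSeries.C ((2 * l + 1)‼ : ℂ) *
          MvPowerSeries.pderiv ℂ k (MvPowerSeries.pderiv ℂ l τ)) -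
          MvPowerSeries.C ((2 * k + 1)‼ : ℂ) * MvPowerSeries.pderiv ℂ k τ *
            (MvPowerSeries.C ((2 * l + 1)‼ : ℂ) * MvPowerSeries.pderiv ℂ l τ) =
          MvPowerSeries.C (((2 * k + 1)‼ : ℂ) * ((2 * l + 1)‼ : ℂ)) *
            (MvPowerSeries.pderiv ℂ k (MvPowerSeries.pderiv ℂ l τ) * τ -
              MvPowerSeries.pderiv ℂ l τ * MvPowerSeries.pderiv ℂ k τ) := by
        rw [map_mul]
        ring
      rw [hC, MvPowerSeries.coeff_C_mul]
      ring
    · have h2 : ¬(e 0 = 2 * k + 2 ∧ e 1 = 2 * l + 2) := fun h => h1 h.2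
      rw [if_neg h1, if_neg h2]
      simp only [mul_zero, map_zero, sub_zero]
  · have h2 : ¬(e 0 = 2 * k + 2 ∧ e 1 = 2 * l + 2) := fun h => h0 h.1
    rw [if_neg h0, if_neg h2]
    simp only [zero_mul, mul_zero, map_zero, sub_zero]

/-- The generating series of the two-point functions is a quadratic expression in the insertion
operators. -/
theorem genSeries_corrNum (τ : Fock) :
    genSeries (corrNum τ) = toFuns (evalSeries₂ τ (insertOp 1 * insertOp 0) * evalSeries₂ τ 1 -
      evalSeries₂ τ (insertOp 1) * evalSeries₂ τ (insertOp 0)) := by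
  ext1 a
  rw [toFuns, RingHom.comp_apply, MvPowerSeries.coeff_map]
  refine congrArg (algebraMap (MvPowerSeries (Fin 2) ℂ) Coef) (MvPowerSeries.ext fun e => ?_)
  rw [coeff_coeff_swap, coeff_coeff_insertOp]
  rfl

end Transfer

/-! ### The wave function and the two-point function -/

section Wave

theorem toFuns_vertex_ne_zero {τ : Fock} (hτ₀ : τ ≠ 0) (i : Fin 2) (u : ℕ → DiffOp) :
    toFuns (evalSeries₂ τ (atVar i (vertex u))) ≠ 0 := by
  rw [Ne, map_eq_zero_iff _ toFuns_injective]
  intro h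
  -- The coefficient of `ξ^0` is `τ`.
  have h1 := congrArg (MvPowerSeries.coeff 0) h
  rw [evalSeries₂_atVar, coeff_atVar, if_pos (by simp), coeff_evalSeries,
    Finsupp.zero_apply, PowerSeries.coeff_zero_eq_constantCoeff_apply, vertex,
    constantCoeff_expInt, evalAt_apply, map_one, map_zero] at h1
  exact hτ₀ h1

theorem shifted_specPar_ne_zero {τ : Fock} (hτ₀ : τ ≠ 0) (i : Fin 2) :
    shifted τ (specPar i) ≠ 0 := by
  rw [← toFuns_shiftOp]
  exact toFuns_vertex_ne_zero hτ₀ i _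

theorem shifted_neg_specPar_ne_zero {τ : Fock} (hτ₀ : τ ≠ 0) (i : Fin 2) :
    shifted τ (neg (specPar i)) ≠ 0 := by
  rw [← toFuns_unshiftOp]
  exact toFuns_vertex_ne_zero hτ₀ i _

theorem map_algebraMap_ne_zero {τ : Fock} (hτ₀ : τ ≠ 0) :
    MvPowerSeries.map (algebraMap ℂ Coef) τ ≠ 0 := by
  rw [← toFuns_one, evalSeries₂_one, Ne, map_eq_zero_iff _ toFuns_injective]
  exact fun h => hτ₀ (MvPowerSeries.C_injective (h.trans (map_zero _).symm))

theorem tauBig_ne_zero {τ : Fock} (hτ₀ : τ ≠ 0) : tauBig τ ≠ 0 := by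
  rw [tauBig, Ne, IsFractionRing.to_map_eq_zero_iff]
  exact map_algebraMap_ne_zero hτ₀

theorem param_neg {k : Type*} [Field k] [Algebra ℂ k] (ι : PowerSeries ℂ →+* k) :
    param (neg ι) = -param ι := by
  rw [param, param, neg, RingHom.comp_apply, PowerSeries.evalNegHom_X, map_neg, inv_neg]

theorem phase_neg {k : Type*} [Field k] (z : k) : phase (-z) = -phase z := by
  ext a
  rw [map_neg, coeff_phase, coeff_phase, ← Finset.sum_neg_distrib]
  refine Finset.sum_congr rfl fun j _ => ?_
  split_ifs
  · rw [(odd_two_mul_add_one j).neg_pow, neg_div]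
  · rw [neg_zero]

theorem expOf_phase_ne_zero (z : Coef) : expOf (phase z) ≠ 0 :=
  left_ne_zero_of_mul_eq_one (expOf_mul_expOf_neg (constantCoeff_phase z))

/-- The logarithmic derivative of the wave function. -/
theorem chi_eq {τ : Fock} (hτ₀ : τ ≠ 0) {ι : PowerSeries ℂ →+* Coef} (hι : shifted τ ι ≠ 0) :
    chi τ ι = algebraMap Funs Big (MvPowerSeries.pderiv Coef 0 (shifted τ ι)) /
        algebraMap Funs Big (shifted τ ι) + paramBig ι -
      algebraMap Funs Big (MvPowerSeries.pderiv Coef 0 (MvPowerSeries.map (algebraMap ℂ Coef) τ)) /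
        tauBig τ := by
  have hT := map_algebraMap_ne_zero hτ₀
  have hT' := tauBig_ne_zero hτ₀
  have hP : algebraMap Funs Big (shifted τ ι) ≠ 0 := by
    rwa [Ne, IsFractionRing.to_map_eq_zero_iff]
  have hE : algebraMap Funs Big (expOf (phase (param ι))) ≠ 0 := by
    rw [Ne, IsFractionRing.to_map_eq_zero_iff]
    exact expOf_phase_ne_zero _
  have hw : wave τ ι = algebraMap Funs Big (shifted τ ι * expOf (phase (param ι))) /
      algebraMap Funs Big (MvPowerSeries.map (algebraMap ℂ Coef) τ) := by
    rw [wave, tauBig, map_mul]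
    ring
  have hD : MvPowerSeries.pderiv Coef 0 (expOf (phase (param ι))) =
      MvPowerSeries.C (param ι) * expOf (phase (param ι)) := by
    rw [pderiv_expOf 0 (constantCoeff_phase _), pderiv_phase]
    simp
  rw [chi, dx, hw, fracDeriv_div _ _ _ hT, Derivation.leibniz, hD, smul_eq_mul, smul_eq_mul]
  simp only [map_sub, map_add, map_mul]
  rw [paramBig]
  rw [tauBig] at hT' ⊢
  field_simp
  ring

theorem resolvent_eq (τ : Fock) (ι : PowerSeries ℂ →+* Coef) :
    resolvent τ ι = algebraMap Funs Big (shifted τ ι * shifted τ (neg ι)) /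
      algebraMap Funs Big (MvPowerSeries.map (algebraMap ℂ Coef) τ ^ 2) := by
  have h := congrArg (algebraMap Funs Big) (expOf_mul_expOf_neg (constantCoeff_phase (param ι)))
  rw [map_mul, map_one] at h
  rw [resolvent, waveDual, wave, wave, param_neg, phase_neg, tauBig, map_mul, map_pow]
  linear_combination (algebraMap Funs Big (shifted τ ι) * algebraMap Funs Big (shifted τ (neg ι)) /
    algebraMap Funs Big (MvPowerSeries.map (algebraMap ℂ Coef) τ) ^ 2) * h

theorem dx_resolvent {τ : Fock} (hτ₀ : τ ≠ 0) {ι : PowerSeries ℂ →+* Coef}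
    (hι : shifted τ ι ≠ 0) (hι' : shifted τ (neg ι) ≠ 0) :
    dx (resolvent τ ι) = resolvent τ ι * (chi τ ι + chi τ (neg ι)) := by
  have hT := map_algebraMap_ne_zero hτ₀
  have hT' := tauBig_ne_zero hτ₀
  have hP : algebraMap Funs Big (shifted τ ι) ≠ 0 := by
    rwa [Ne, IsFractionRing.to_map_eq_zero_iff]
  have hQ : algebraMap Funs Big (shifted τ (neg ι)) ≠ 0 := by
    rwa [Ne, IsFractionRing.to_map_eq_zero_iff]
  have hz : paramBig (neg ι) = -paramBig ι := by
    rw [paramBig, paramBig, param_neg, map_neg, map_neg]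
  rw [chi_eq hτ₀ hι, chi_eq hτ₀ hι', hz, resolvent_eq, dx, fracDeriv_div _ _ _ (pow_ne_zero 2 hT),
    Derivation.leibniz, Derivation.leibniz_pow]
  simp only [map_sub, map_add, map_mul, map_pow, smul_eq_mul, two_nsmul]
  rw [tauBig] at hT' ⊢
  field_simp
  ring

end Wave

/-! ### The two-point formula -/

section TwoPoint

theorem X_sq_ne_X_sq :
    (MvPowerSeries.X 0 ^ 2 : MvPowerSeries (Fin 2) ℂ) ≠ MvPowerSeries.X 1 ^ 2 := by
  classical
  intro h
  have h1 := congrArg (MvPowerSeries.coeff (Finsupp.single 0 2)) h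
  rw [MvPowerSeries.coeff_X_pow, MvPowerSeries.coeff_X_pow, if_pos rfl, if_neg] at h1
  · exact one_ne_zero h1
  · intro h2
    have := DFunLike.congr_fun h2 0
    simp at this

theorem paramBig_specPar (i : Fin 2) :
    paramBig (specPar i) = (algebraMap Funs Big (toFuns (MvPowerSeries.X i)))⁻¹ := by
  refine (inv_eq_of_mul_eq_one_right ?_).symm
  rw [paramBig, ← map_mul, toFuns_X, map_one]

theorem paramBig_ne_zero (i : Fin 2) : paramBig (specPar i) ≠ 0 := by
  refine right_ne_zero_of_mul_eq_one (a := algebraMap Funs Big (toFuns (MvPowerSeries.X i))) ?_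
  rw [paramBig, ← map_mul, toFuns_X, map_one]

theorem paramBig_sq_sub_sq_ne_zero :
    paramBig (specPar 0) ^ 2 - paramBig (specPar 1) ^ 2 ≠ 0 := by
  rw [sub_ne_zero, paramBig_specPar, paramBig_specPar, inv_pow, inv_pow, Ne, inv_inj, ← map_pow,
    ← map_pow, ← map_pow, ← map_pow]
  intro h
  have h1 := toFuns_injective (IsFractionRing.injective Funs Big h)
  have h2 := congrArg (fun F => MvPowerSeries.map MvPowerSeries.constantCoeff F) h1
  simp only [map_pow, MvPowerSeries.map_X] at h2
  exact X_sq_ne_X_sq h2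

/-- The embedding `ℂ[[t]][[z⁻¹, w⁻¹]] → Big`. -/
def toBig : MvPowerSeries (Fin 2) Fock →+* Big := (algebraMap Funs Big).comp toFuns

theorem toBig_X (i : Fin 2) : toBig (MvPowerSeries.X i) = (paramBig (specPar i))⁻¹ := by
  rw [paramBig_specPar, inv_inv]
  rfl

theorem toBig_one (τ : Fock) : toBig (evalSeries₂ τ 1) = tauBig τ := by
  rw [toBig, RingHom.comp_apply, toFuns_one, tauBig]

theorem paramBig_neg (ι : PowerSeries ℂ →+* Coef) : paramBig (neg ι) = -paramBig ι := by
  rw [paramBig, paramBig, param_neg, map_neg, map_neg]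

theorem toBig_shiftOp_ne_zero {τ : Fock} (hτ₀ : τ ≠ 0) (i : Fin 2) :
    toBig (evalSeries₂ τ (shiftOp i)) ≠ 0 := by
  rw [toBig, RingHom.comp_apply, toFuns_shiftOp, Ne, IsFractionRing.to_map_eq_zero_iff]
  exact shifted_specPar_ne_zero hτ₀ i

theorem toBig_unshiftOp_ne_zero {τ : Fock} (hτ₀ : τ ≠ 0) (i : Fin 2) :
    toBig (evalSeries₂ τ (unshiftOp i)) ≠ 0 := by
  rw [toBig, RingHom.comp_apply, toFuns_unshiftOp, Ne, IsFractionRing.to_map_eq_zero_iff]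
  exact shifted_neg_specPar_ne_zero hτ₀ i

/-- The logarithmic derivative `τ_x / τ`. -/
def logDerivTau (τ : Fock) : Big :=
  algebraMap Funs Big (MvPowerSeries.pderiv Coef 0 (MvPowerSeries.map (algebraMap ℂ Coef) τ)) /
    tauBig τ

theorem chi_specPar {τ : Fock} (hτ₀ : τ ≠ 0) (i : Fin 2) :
    chi τ (specPar i) = toBig (evalSeries₂ τ (dxOp * shiftOp i)) /
      toBig (evalSeries₂ τ (shiftOp i)) + paramBig (specPar i) - logDerivTau τ := by
  rw [chi_eq hτ₀ (shifted_specPar_ne_zero hτ₀ i), toBig, RingHom.comp_apply, RingHom.comp_apply,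
    toFuns_dxOp_mul_shiftOp, toFuns_shiftOp, logDerivTau]

theorem chi_neg_specPar {τ : Fock} (hτ₀ : τ ≠ 0) (i : Fin 2) :
    chi τ (neg (specPar i)) = toBig (evalSeries₂ τ (dxOp * unshiftOp i)) /
      toBig (evalSeries₂ τ (unshiftOp i)) - paramBig (specPar i) - logDerivTau τ := by
  rw [chi_eq hτ₀ (shifted_neg_specPar_ne_zero hτ₀ i), toBig, RingHom.comp_apply,
    RingHom.comp_apply, toFuns_dxOp_mul_unshiftOp, toFuns_unshiftOp, logDerivTau, paramBig_neg,
    ← sub_eq_add_neg]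

theorem resolvent_specPar (τ : Fock) (i : Fin 2) :
    resolvent τ (specPar i) = toBig (evalSeries₂ τ (shiftOp i)) *
      toBig (evalSeries₂ τ (unshiftOp i)) / tauBig τ ^ 2 := by
  rw [resolvent_eq, toBig, RingHom.comp_apply, RingHom.comp_apply, toFuns_shiftOp,
    toFuns_unshiftOp, map_mul, map_pow, tauBig]

/-- The Wronskian of `ψ(z)` and `ψ(-z)` is `-2 z`. -/
theorem resolvent_mul_chi_sub_chi {τ : Fock} (hτ₀ : τ ≠ 0) (hτ : IsTauFunction τ) (i : Fin 2) :
    resolvent τ (specPar i) * (chi τ (specPar i) - chi τ (neg (specPar i))) =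
      2 * paramBig (specPar i) := by
  have h := congrArg toBig (shift_unshift_wronskian hτ i)
  have hP := toBig_shiftOp_ne_zero hτ₀ i
  have hQ := toBig_unshiftOp_ne_zero hτ₀ i
  have hT := tauBig_ne_zero hτ₀
  have hz := paramBig_ne_zero i
  simp only [map_sub, map_mul toBig, toBig_X, toBig_one, map_ofNat] at h
  rw [inv_mul_eq_iff_eq_mul₀ hz] at h
  rw [resolvent_specPar, chi_specPar hτ₀, chi_neg_specPar hτ₀]
  generalize toBig (evalSeries₂ τ (shiftOp i)) = P at *
  generalize toBig (evalSeries₂ τ (unshiftOp i)) = Q at *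
  field_simp
  linear_combination -h

/-- The Wronskian of `ψ(z)` and `ψ(w)`. -/
theorem shift_mul_chi_sub_chi {τ : Fock} (hτ₀ : τ ≠ 0) (hτ : IsTauFunction τ) :
    toBig (evalSeries₂ τ (shiftOp 0)) * toBig (evalSeries₂ τ (shiftOp 1)) *
        (chi τ (specPar 0) - chi τ (specPar 1)) =
      (paramBig (specPar 0) - paramBig (specPar 1)) *
        (tauBig τ * toBig (evalSeries₂ τ (shiftOp 0 * shiftOp 1))) := by
  have h := congrArg toBig (shift_wronskian hτ)
  have hP := toBig_shiftOp_ne_zero hτ₀ 0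
  have hP' := toBig_shiftOp_ne_zero hτ₀ 1
  have hz := paramBig_ne_zero 0
  have hw := paramBig_ne_zero 1
  simp only [map_sub, map_mul toBig, toBig_X, toBig_one] at h
  rw [chi_specPar hτ₀, chi_specPar hτ₀]
  generalize toBig (evalSeries₂ τ (shiftOp 0)) = P at *
  generalize toBig (evalSeries₂ τ (shiftOp 1)) = P' at *
  generalize paramBig (specPar 0) = z at *
  generalize paramBig (specPar 1) = w at *
  field_simp at h ⊢
  linear_combination -h

/-- The Wronskian of `ψ(-z)` and `ψ(-w)`. -/
theorem unshift_mul_chi_sub_chi {τ : Fock} (hτ₀ : τ ≠ 0) (hτ : IsTauFunction τ) :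
    toBig (evalSeries₂ τ (unshiftOp 0)) * toBig (evalSeries₂ τ (unshiftOp 1)) *
        (chi τ (neg (specPar 0)) - chi τ (neg (specPar 1))) =
      -((paramBig (specPar 0) - paramBig (specPar 1)) *
        (tauBig τ * toBig (evalSeries₂ τ (unshiftOp 0 * unshiftOp 1)))) := by
  have h := congrArg toBig (unshift_wronskian hτ)
  have hP := toBig_unshiftOp_ne_zero hτ₀ 0
  have hP' := toBig_unshiftOp_ne_zero hτ₀ 1
  have hz := paramBig_ne_zero 0
  have hw := paramBig_ne_zero 1
  simp only [map_sub, map_mul toBig, toBig_X, toBig_one] at h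
  rw [chi_neg_specPar hτ₀, chi_neg_specPar hτ₀]
  generalize toBig (evalSeries₂ τ (unshiftOp 0)) = P at *
  generalize toBig (evalSeries₂ τ (unshiftOp 1)) = P' at *
  generalize paramBig (specPar 0) = z at *
  generalize paramBig (specPar 1) = w at *
  field_simp at h ⊢
  linear_combination -h

theorem sq_mul_F₂ {τ : Fock} (hτ₀ : τ ≠ 0) (hτ : IsTauFunction τ) :
    (paramBig (specPar 0) + paramBig (specPar 1)) ^ 2 * (F₂ τ * tauBig τ ^ 2) =
      toBig (evalSeries₂ τ (unshiftOp 0 * unshiftOp 1)) *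
        toBig (evalSeries₂ τ (shiftOp 0 * shiftOp 1)) - tauBig τ ^ 2 := by
  have h := congrArg toBig (insert_insert hτ)
  have hT := tauBig_ne_zero hτ₀
  have hz := paramBig_ne_zero 0
  have hw := paramBig_ne_zero 1
  rw [map_mul toBig, toBig, RingHom.comp_apply _ _ (_ - _), ← genSeries_corrNum, ← toBig] at h
  simp only [map_sub, map_add, map_pow, map_mul toBig, toBig_X, toBig_one] at h
  rw [F₂, div_mul_cancel₀ _ (pow_ne_zero 2 hT)]
  generalize paramBig (specPar 0) = z at *
  generalize paramBig (specPar 1) = w at *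
  field_simp at h
  linear_combination h

/-- The two-point function in terms of `R(z)`, `R(w)` and the logarithmic derivatives of the wave
functions. -/
theorem F₂_mul_sq {τ : Fock} (hτ₀ : τ ≠ 0) (hτ : IsTauFunction τ) :
    F₂ τ * (paramBig (specPar 0) ^ 2 - paramBig (specPar 1) ^ 2) ^ 2 =
      -(resolvent τ (specPar 0) * resolvent τ (specPar 1) *
        (chi τ (specPar 0) - chi τ (specPar 1)) *
        (chi τ (neg (specPar 0)) - chi τ (neg (specPar 1)))) -
        (paramBig (specPar 0) - paramBig (specPar 1)) ^ 2 := by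
  have h := sq_mul_F₂ hτ₀ hτ
  have hs := shift_mul_chi_sub_chi hτ₀ hτ
  have hu := unshift_mul_chi_sub_chi hτ₀ hτ
  have hT := tauBig_ne_zero hτ₀
  have hsu := congrArg₂ (· * ·) hs hu
  rw [resolvent_specPar, resolvent_specPar]
  generalize F₂ τ = F at *
  generalize tauBig τ = T at *
  have hT4 : T ^ 4 ≠ 0 := pow_ne_zero 4 hT
  apply mul_right_cancel₀ hT4
  field_simp
  linear_combination (T ^ 2 * (paramBig (specPar 0) - paramBig (specPar 1)) ^ 2) * h + hsu

end TwoPoint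

end KdV

end

theorem proposition1p5 (τ : KdV.Fock) (hτ₀ : τ ≠ 0) (hτ : KdV.IsTauFunction τ) :
    KdV.F₂ τ =
      (1 / 2 * KdV.dx (KdV.resolvent τ KdV.wPar) * KdV.dx (KdV.resolvent τ KdV.zPar)
        - KdV.resolvent τ KdV.wPar * KdV.resolvent τ KdV.zPar *
            KdV.chi τ KdV.zPar * KdV.chi τ (KdV.neg KdV.zPar)
        - KdV.resolvent τ KdV.zPar * KdV.resolvent τ KdV.wPar *
            KdV.chi τ KdV.wPar * KdV.chi τ (KdV.neg KdV.wPar)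
        - (KdV.paramBig KdV.zPar ^ 2 + KdV.paramBig KdV.wPar ^ 2)) /
      (KdV.paramBig KdV.zPar ^ 2 - KdV.paramBig KdV.wPar ^ 2) ^ 2 := by
  rw [KdV.zPar_eq, KdV.wPar_eq, eq_div_iff (pow_ne_zero 2 KdV.paramBig_sq_sub_sq_ne_zero),
    KdV.F₂_mul_sq hτ₀ hτ,
    KdV.dx_resolvent hτ₀ (KdV.shifted_specPar_ne_zero hτ₀ 0)
      (KdV.shifted_neg_specPar_ne_zero hτ₀ 0),
    KdV.dx_resolvent hτ₀ (KdV.shifted_specPar_ne_zero hτ₀ 1)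
      (KdV.shifted_neg_specPar_ne_zero hτ₀ 1)]
  -- With `D(z) = R(z) (χ(z) - χ(-z))`, the two sides differ by `(D(z) D(w) - 4 z w) / 2`.
  have h := congrArg₂ (· * ·) (KdV.resolvent_mul_chi_sub_chi hτ₀ hτ 0)
    (KdV.resolvent_mul_chi_sub_chi hτ₀ hτ 1)
  have : CharZero KdV.Coef := charZero_of_injective_algebraMap (algebraMap ℂ KdV.Coef).injective
  have : CharZero KdV.Big :=
    charZero_of_injective_ringHom ((algebraMap KdV.Funs KdV.Big).comp MvPowerSeries.C).injective
  linear_combination (-1 / 2) * h
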